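/- Let $r\ge 0$, $T\ge 0$ be integers, $\overline s=(s_1,\dots,s_r)$ and $\overline d=(d_1,\dots,d_r)$ vectors of positive integers, and call a vector $\overline\mu\in\mathbb Z^r$ a step if all its components are positive or all are negative. For a sequence $\{\eta(m),m\in\mathbb Z\}$ of complex random variables define the generalized multiple (GM) increment $$\chi_{\overline\mu,\overline s}^{(d)}(\eta(m))=\sum_{l_1=0}^{d_1}\cdots\sum_{l_r=0}^{d_r}(-1)^{l_1+\dots+l_r}\binom{d_1}{l_1}\cdots\binom{d_r}{l_r}\,\eta(m-\mu_1s_1l_1-\cdots-\mu_rs_rl_r).$$ Let $\vec\xi(m)=(\xi_1(m),\dots,\xi_T(m))$, $m\in\mathbb Z$, be a sequence of complex random vectors on a probability space with (wide sense) stationary GM increments: for all steps $\overline\mu,\overline\mu_1,\overline\mu_2$ the increments $\chi_{\overline\mu,\overline s}^{(d)}(\xi_p(m))$ have finite second moments, and $\mathsf E\,\chi_{\overline\mu,\overline s}^{(d)}(\xi_p(m_0))$ and $$D_{pq}(m;\overline\mu_1,\overline\mu_2)=\mathsf E\,\chi_{\overline\mu_1,\overline s}^{(d)}(\xi_p(m_0+m))\,\overline{\chi_{\overline\mu_2,\overline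 s}^{(d)}(\xi_q(m_0))},\qquad p,q=1,\dots,T,$$ do not depend on $m_0$. The matrix-valued function $D(m;\overline\mu_1,\overline\mu_2)$ is the structural function. Put $$\chi_{\overline\mu}^{(d)}(z)=\prod_{j=1}^r(1-z^{\mu_js_j})^{d_j},\qquad \beta^{(d)}(i\lambda)=\prod_{j=1}^r\prod_{k=-[s_j/2]}^{[s_j/2]}\Bigl(i\lambda-\frac{2\pi i k}{s_j}\Bigr)^{d_j};$$ below, quotients with denominator $\beta^{(d)}(i\lambda)$ or $|\beta^{(d)}(i\lambda)|^2$ are extended by continuity to the zeros of $\beta^{(d)}(i\lambda)$, which are removable singularities. Then there is a left-continuous bounded matrix-valued function $F(\lambda)=\{F_{pq}(\lambda)\}_{p,q=1}^T$ on $[-\pi,\pi)$, nondecreasing in the sense that $F(\lambda_2)-F(\lambda_1)$ is Hermitian positive semidefinite for $\lambda_1\le\lambda_2$, such that for all $m\in\mathbb Z$ and all steps $\overline\mu_1,\overline\mu_2$ $$D(m;\overline\mu_1,\overline\mu_2)=\int_{-\pi}^{\pi}e^{i\lambda m}\,\chi_{\overline\mu_1}^{(d)}(e^{-i\lambda})\,\chi_{\overline\mu_2}^{(d)}(e^{i\lambda})\,\frac{1}{|\beta^{(d)}(i\lambda)|^2}\,dF(\lambda).$$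 The function $F$ (the spectral function) is unique up to an additive constant matrix. Moreover, there is a vector-valued process $\vec Z(\lambda)=\{Z_p(\lambda)\}_{p=1}^T$ on $[-\pi,\pi)$ with square integrable components, not depending on $\overline\mu$ and $m$, whose increments over non-overlapping intervals are uncorrelated and orthogonal (for all pairs of components), such that $$\mathsf E\,(Z_p(\lambda_2)-Z_p(\lambda_1))\overline{(Z_q(\lambda_2)-Z_q(\lambda_1))}=F_{pq}(\lambda_2)-F_{pq}(\lambda_1),\qquad -\pi\le\lambda_1<\lambda_2<\pi,\quad p,q=1,\dots,T,$$ and for every step $\overline\mu$ and every $m\in\mathbb Z$, almost surely, $$\chi_{\overline\mu,\overline s}^{(d)}(\vec\xi(m))=\int_{-\pi}^{\pi}e^{im\lambda}\,\chi_{\overline\mu}^{(d)}(e^{-i\lambda})\,\frac{1}{\beta^{(d)}(i\lambda)}\,d\vec Z(\lambda),$$ the integral being the mean-square stochastic integral. Functions on $[-\pi,\pi)$ are extended to $\pi$ by their left limits (for $\vec Z$ in mean square), and the integrals are Riemann--Stieltjes integrals of continuous functions over $[-\pi,\pi]$. -/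

import Mathlib

open MeasureTheory Filter Topology ComplexConjugate
open scoped ComplexOrder

noncomputable section

/-- Admissible varying steps: all components positive, or all components negative. -/
def IsStep {r : ℕ} (μ : Fin r → ℤ) : Prop :=
  (∀ i, 0 < μ i) ∨ (∀ i, μ i < 0)

/-- The generalized multiple increment
`(1 - B^(μ₁ s₁))^(d₁) ⋯ (1 - B^(μᵣ sᵣ))^(dᵣ) η (m)`, expanded, with `B η (m) = η (m - 1)`. -/
def gmIncrement {Ω : Type*} {r : ℕ} (s d : Fin r → ℕ) (μ : Fin r → ℤ)
    (η : ℤ → Ω → ℂ) (m : ℤ) (ω : Ω) : ℂ :=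
  ∑ l ∈ Fintype.piFinset (fun i => Finset.range (d i + 1)),
    ((-1 : ℂ) ^ (∑ i, l i) * ∏ i, ((d i).choose (l i) : ℂ)) *
      η (m - ∑ i, μ i * (s i : ℤ) * (l i : ℤ)) ω

/-- The sequence of random vectors `(ξ 0 m, …, ξ (T-1) m)` has wide sense stationary generalized
multiple increments: for all admissible steps the increments have finite second moments, and their
means and second-order mixed moments do not depend on the time origin. -/
structure IsStationaryGM {Ω : Type*} [MeasurableSpace Ω] (P : Measure Ω) {r T : ℕ}
    (s d : Fin r → ℕ) (ξ : Fin T → ℤ → Ω → ℂ) : Prop where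
  aemeasurable : ∀ p m, AEMeasurable (ξ p m) P
  memLp : ∀ μ, IsStep μ → ∀ p m, MemLp (gmIncrement s d μ (ξ p) m) 2 P
  mean : ∀ μ, IsStep μ → ∀ p m₀,
    ∫ ω, gmIncrement s d μ (ξ p) m₀ ω ∂P = ∫ ω, gmIncrement s d μ (ξ p) 0 ω ∂P
  structural : ∀ μ₁ μ₂, IsStep μ₁ → IsStep μ₂ → ∀ p q m m₀,
    ∫ ω, gmIncrement s d μ₁ (ξ p) (m₀ + m) ω * conj (gmIncrement s d μ₂ (ξ q) m₀ ω) ∂P =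
      ∫ ω, gmIncrement s d μ₁ (ξ p) m ω * conj (gmIncrement s d μ₂ (ξ q) 0 ω) ∂P

/-- The matrix-valued structural function `D (m; μ₁, μ₂)`. -/
def structuralFunction {Ω : Type*} [MeasurableSpace Ω] (P : Measure Ω) {r T : ℕ}
    (s d : Fin r → ℕ) (ξ : Fin T → ℤ → Ω → ℂ) (m : ℤ) (μ₁ μ₂ : Fin r → ℤ) :
    Matrix (Fin T) (Fin T) ℂ :=
  fun p q => ∫ ω, gmIncrement s d μ₁ (ξ p) m ω * conj (gmIncrement s d μ₂ (ξ q) 0 ω) ∂P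

/-- The symbol `χ_μ (z) = ∏ⱼ (1 - z^(μⱼ sⱼ))^(dⱼ)`. -/
def gmSymbol {r : ℕ} (s d : Fin r → ℕ) (μ : Fin r → ℤ) (z : ℂ) : ℂ :=
  ∏ j, (1 - z ^ (μ j * (s j : ℤ))) ^ d j

/-- `β (i x) = ∏ⱼ ∏ₖ (i x - 2 π i k / sⱼ)^(dⱼ)`, where `k` runs from `-[sⱼ/2]` to `[sⱼ/2]`. -/
def gmBeta {r : ℕ} (s d : Fin r → ℕ) (x : ℝ) : ℂ :=
  ∏ j, ∏ k ∈ Finset.Icc (-((s j / 2 : ℕ) : ℤ)) ((s j / 2 : ℕ) : ℤ),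
    (Complex.I * (x : ℂ) - 2 * (Real.pi : ℂ) * Complex.I * (k : ℂ) / (s j : ℂ)) ^ d j

/-- The value at `x` of the continuous extension of `f` over removable singularities. -/
def contExt (f : ℝ → ℂ) (x : ℝ) : ℂ := limUnder (𝓝[≠] x) f

/-- `e^(i m x) χ_μ (e^(-i x)) / β (i x)`; the quotient is extended by continuity to the zeros
of `β`, which are also zeros, of at least the same order, of the numerator. -/
def spectralKernel {r : ℕ} (s d : Fin r → ℕ) (μ : Fin r → ℤ) (m : ℤ) (x : ℝ) : ℂ :=
  Complex.exp (Complex.I * (m : ℂ) * (x : ℂ)) *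
    contExt (fun y : ℝ => gmSymbol s d μ (Complex.exp (-(Complex.I * (y : ℂ)))) / gmBeta s d y) x

/-- `e^(i m x) χ_μ₁ (e^(-i x)) χ_μ₂ (e^(i x)) / |β (i x)|²`, extended by continuity in the
same way. -/
def structuralKernel {r : ℕ} (s d : Fin r → ℕ) (μ₁ μ₂ : Fin r → ℤ) (m : ℤ) (x : ℝ) : ℂ :=
  Complex.exp (Complex.I * (m : ℂ) * (x : ℂ)) *
    contExt (fun y : ℝ => gmSymbol s d μ₁ (Complex.exp (-(Complex.I * (y : ℂ)))) *
      gmSymbol s d μ₂ (Complex.exp (Complex.I * (y : ℂ))) / ((‖gmBeta s d y‖ ^ 2 : ℝ) : ℂ)) x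

/-- `I` is the Riemann–Stieltjes integral `∫_a^b f dG`: the sums over tagged partitions
`a = t 0 ≤ τ 0 ≤ t 1 ≤ τ 1 ≤ ⋯ ≤ t n = b` converge to `I` in norm as the mesh tends to zero.
For `E = ℂ` this is the ordinary integral, for `E = L²(P)` the mean-square stochastic integral. -/
def HasRSIntegral {E : Type*} [NormedAddCommGroup E] [NormedSpace ℂ E]
    (f : ℝ → ℂ) (G : ℝ → E) (a b : ℝ) (I : E) : Prop :=
  ∀ ε > 0, ∃ δ > 0, ∀ (n : ℕ) (t τ : ℕ → ℝ), t 0 = a → t n = b →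
    (∀ i < n, t i ≤ τ i ∧ τ i ≤ t (i + 1) ∧ t (i + 1) - t i < δ) →
    ‖∑ i ∈ Finset.range n, f (τ i) • (G (t (i + 1)) - G (t i)) - I‖ < ε

/-- A matrix-valued distribution function on `[-π, π)`: left-continuous, and nondecreasing for the
order of Hermitian matrices. The value at `π` is the left limit there (so that `F` is bounded and
has no mass at `π`); values outside `[-π, π]` are irrelevant. -/
structure IsMatrixDistribution {T : ℕ} (F : ℝ → Matrix (Fin T) (Fin T) ℂ) : Prop where
  mono : ∀ a b, -Real.pi ≤ a → a ≤ b → b ≤ Real.pi → (F b - F a).PosSemidef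
  left_cont : ∀ x, -Real.pi < x → x ≤ Real.pi → ContinuousWithinAt F (Set.Iio x) x

/-- `F` is a spectral function of the stationary increments of `ξ`: a matrix-valued distribution
function such that
`D (m; μ₁, μ₂) = ∫_{-π}^{π} e^(imx) χ_μ₁ (e^(-ix)) χ_μ₂ (e^(ix)) |β (ix)|⁻² dF(x)`, entrywise. -/
def IsSpectralFunction {Ω : Type*} [MeasurableSpace Ω] (P : Measure Ω) {r T : ℕ}
    (s d : Fin r → ℕ) (ξ : Fin T → ℤ → Ω → ℂ) (F : ℝ → Matrix (Fin T) (Fin T) ℂ) : Prop :=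
  IsMatrixDistribution F ∧
    ∀ μ₁ μ₂, IsStep μ₁ → IsStep μ₂ → ∀ (m : ℤ) (p q : Fin T),
      HasRSIntegral (structuralKernel s d μ₁ μ₂ m) (fun x => F x p q) (-Real.pi) Real.pi
        (structuralFunction P s d ξ m μ₁ μ₂ p q)

/-- The increments of the vector process `Z` over non-overlapping intervals of `[-π, π]` are
uncorrelated, and moreover orthogonal (the two notions differ if the increments are not
centred). -/
structure HasUncorrelatedIncrements {Ω : Type*} [MeasurableSpace Ω] (P : Measure Ω) {T : ℕ}
    (Z : Fin T → ℝ → Lp ℂ 2 P) : Prop where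
  uncorrelated : ∀ p q a b a' b', -Real.pi ≤ a → a ≤ b → b ≤ a' → a' ≤ b' → b' ≤ Real.pi →
    ∫ ω, (Z p b - Z p a) ω * conj ((Z q b' - Z q a') ω) ∂P =
      (∫ ω, (Z p b - Z p a) ω ∂P) * conj (∫ ω, (Z q b' - Z q a') ω ∂P)
  orthogonal : ∀ p q a b a' b', -Real.pi ≤ a → a ≤ b → b ≤ a' → a' ≤ b' → b' ≤ Real.pi →
    ∫ ω, (Z p b - Z p a) ω * conj ((Z q b' - Z q a') ω) ∂P = 0

end

/-!
The theorem is reduced to the spectral theory of an ordinary stationary sequence.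

For unit steps the increment `η = χ₁(ξ)` is a stationary vector sequence with finite second
moments. In the ring of Laurent polynomials in the backward shift `B` the operator
`∏ⱼ (1 - B^(μⱼ sⱼ))^(dⱼ)` is a multiple of `∏ⱼ (1 - B^(sⱼ))^(dⱼ)` (`gmLaurent_one_dvd`), so all
other increments are finite moving averages of `η`, and their symbols are multiples of the symbol
of the unit step by the same transfer function (`exists_movingAverage`). Moreover
`χ₁(e^(-iy)) = κ(y) β(iy)` with a continuous `κ` that has no zeros on `[-π, π]`
(`exists_continuous_quotient`): the zeros of the left-hand side in that interval are exactly those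
of `β`, with the same multiplicities. Hence the spectral data of `ξ` are those of `η` divided by
`|κ|²` and by `κ`.

For `η`, Herglotz's theorem (`exists_measure_integral_fourier`) gives a measure `σ` on the circle,
the trace of the matrix spectral measure, and bounded operators `V p : L²(σ) → L²(P)` with
`V p (e^(im·)) = η p m` (`exists_spectral_operators`). The inner product `⟨V q g, V p f⟩` depends
only on `f * conj g` and is a continuous linear functional of it (`inner_eq_crossFunctional`);
this functional is integration against the density of the spectral measure of `(η p, η q)`. One
sets `Z p x = V p (1_[-π, x) / κ)`. Orthogonality of the increments and `E ΔZ_p conj ΔZ_q = ΔF_pq`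
follow at once, and all Riemann–Stieltjes integrals, scalar or stochastic, are instances of one
statement about bounded operators on `L²(σ)` (`hasRSIntegral_of_increments`). The increments are
also uncorrelated because the mean of the random spectral measure is an atom at the frequency `0`
(`eq_zero_of_const_on_expChar`), and two disjoint intervals do not both contain `0`.

Uniqueness: the Hermitian form of a matrix distribution function at a fixed vector is the
distribution function of a measure on the circle, whose product with `|κ|²` has prescribed Fourier
coefficients (`increment_eq_of_hasRSIntegral`, `IsMatrixDistribution.sub_eq_sub`).
-/

/-! ### Increment operators as Laurent polynomials in the backward shift -/

section BackwardShift

open LaurentPolynomial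

/-- The action of Laurent polynomials on two-sided sequences in which the indeterminate acts as
the backward shift `B η (m) = η (m - 1)`. -/
noncomputable def backwardShift : LaurentPolynomial ℂ →ₐ[ℂ] Module.End ℂ (ℤ → ℂ) :=
  AddMonoidAlgebra.lift ℂ (Module.End ℂ (ℤ → ℂ)) ℤ
    { toFun := fun n => LinearMap.funLeft ℂ ℂ (fun m : ℤ => m - n.toAdd)
      map_one' := by ext; simp [LinearMap.funLeft]
      map_mul' := fun a b => by
        refine LinearMap.ext fun η => funext fun m => ?_
        simp [LinearMap.funLeft_apply, Module.End.mul_apply, sub_sub] }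

lemma backwardShift_T (n : ℤ) (η : ℤ → ℂ) (m : ℤ) : backwardShift (T n) η m = η (m - n) := by
  rw [backwardShift, LaurentPolynomial.T, AddMonoidAlgebra.lift_single, one_smul]
  rfl

/-- The Laurent polynomial `∏ⱼ (1 - X^(μⱼ sⱼ))^(dⱼ)` behind the generalized multiple increment. -/
noncomputable def gmLaurent {r : ℕ} (s d : Fin r → ℕ) (μ : Fin r → ℤ) : LaurentPolynomial ℂ :=
  ∏ j, (1 - T (μ j * (s j : ℤ))) ^ d j

lemma one_sub_T_pow (n : ℤ) (d : ℕ) : (1 - T n : LaurentPolynomial ℂ) ^ d =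
    ∑ l ∈ Finset.range (d + 1), ((-1 : ℂ) ^ l * (d.choose l : ℂ)) • T (n * l) := by
  rw [sub_eq_neg_add, add_pow]
  refine Finset.sum_congr rfl fun l _ => ?_
  rw [one_pow, mul_one, neg_pow, T_pow, mul_comm n, Algebra.smul_def]
  simp
  ring

lemma gmLaurent_eq_sum {r : ℕ} (s d : Fin r → ℕ) (μ : Fin r → ℤ) : gmLaurent s d μ =
    ∑ l ∈ Fintype.piFinset (fun i => Finset.range (d i + 1)),
      ((-1 : ℂ) ^ (∑ i, l i) * ∏ i, ((d i).choose (l i) : ℂ)) •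
        T (∑ i, μ i * (s i : ℤ) * (l i : ℤ)) := by
  have hT : ∀ (f : Fin r → ℤ), (∏ i, T (f i) : LaurentPolynomial ℂ) = T (∑ i, f i) := by
    intro f
    induction (Finset.univ : Finset (Fin r)) using Finset.cons_induction with
    | empty => simp
    | cons a t ha ih => rw [Finset.prod_cons, Finset.sum_cons, ih, T_add]
  unfold gmLaurent
  simp_rw [one_sub_T_pow]
  rw [Finset.prod_univ_sum]
  refine Finset.sum_congr rfl fun l _ => ?_
  rw [← hT, ← Finset.prod_pow_eq_pow_sum, ← Finset.prod_mul_distrib]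
  simp_rw [Algebra.smul_def]
  rw [Finset.prod_mul_distrib, map_prod]

lemma gmIncrement_eq_backwardShift {Ω : Type*} {r : ℕ} (s d : Fin r → ℕ) (μ : Fin r → ℤ)
    (η : ℤ → Ω → ℂ) (m : ℤ) (ω : Ω) :
    gmIncrement s d μ η m ω = backwardShift (gmLaurent s d μ) (fun k => η k ω) m := by
  rw [gmLaurent_eq_sum, map_sum, LinearMap.sum_apply, Finset.sum_apply, gmIncrement]
  refine Finset.sum_congr rfl fun l _ => ?_
  rw [map_smul, LinearMap.smul_apply, Pi.smul_apply, backwardShift_T, smul_eq_mul]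

/-- Evaluation of a Laurent polynomial at a unit. -/
noncomputable def laurentEval (z : ℂˣ) : LaurentPolynomial ℂ →ₐ[ℂ] ℂ :=
  AddMonoidAlgebra.lift ℂ ℂ ℤ ((Units.coeHom ℂ).comp (zpowersHom ℂˣ z))

lemma laurentEval_T (z : ℂˣ) (n : ℤ) : laurentEval z (T n) = (z : ℂ) ^ n := by
  rw [laurentEval, LaurentPolynomial.T, AddMonoidAlgebra.lift_single, one_smul]
  simp

lemma gmSymbol_eq_laurentEval {r : ℕ} (s d : Fin r → ℕ) (μ : Fin r → ℤ) (z : ℂˣ) :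
    gmSymbol s d μ z = laurentEval z (gmLaurent s d μ) := by
  simp [gmSymbol, gmLaurent, laurentEval_T]

lemma one_sub_T_dvd (a n : ℤ) : (1 - T n : LaurentPolynomial ℂ) ∣ 1 - T (a * n) := by
  have key : ∀ k : ℕ, (1 - T n : LaurentPolynomial ℂ) ∣ 1 - T (k * n) := fun k => by
    have h := sub_dvd_pow_sub_pow (1 : LaurentPolynomial ℂ) (T n) k
    rwa [one_pow, T_pow] at h
  obtain ⟨k, rfl | rfl⟩ := a.eq_nat_or_neg
  · exact key k
  · have h : (1 - T (-(k : ℤ) * n) : LaurentPolynomial ℂ) =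
        (1 - T (k * n)) * (-T (-(k : ℤ) * n)) := by
      rw [sub_mul, mul_neg, mul_neg, ← T_add]
      simp
      ring
    rw [h]
    exact (key k).mul_right _

lemma gmLaurent_one_dvd {r : ℕ} (s d : Fin r → ℕ) (μ : Fin r → ℤ) :
    gmLaurent s d 1 ∣ gmLaurent s d μ :=
  Finset.prod_dvd_prod_of_dvd _ _ fun j _ => pow_dvd_pow_of_dvd (by
    simpa using one_sub_T_dvd (μ j) (s j : ℤ)) _

/-- Every increment is a finite moving average of the increments with unit steps, and the symbols
are related by the transfer function of that moving average. -/
lemma exists_movingAverage {Ω : Type*} {r : ℕ} (s d : Fin r → ℕ) (μ : Fin r → ℤ) :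
    ∃ (S : Finset ℤ) (c : ℤ → ℂ),
      (∀ (η : ℤ → Ω → ℂ) (m : ℤ) (ω : Ω), gmIncrement s d μ η m ω =
        ∑ k ∈ S, c k * gmIncrement s d 1 η (m - k) ω) ∧
      ∀ z : ℂ, z ≠ 0 → gmSymbol s d μ z = (∑ k ∈ S, c k * z ^ k) * gmSymbol s d 1 z := by
  obtain ⟨q, hq⟩ := gmLaurent_one_dvd s d μ
  rw [mul_comm] at hq
  have hsum : q = ∑ k ∈ q.coeff.support, q.coeff k • T k := by
    conv_lhs => rw [← AddMonoidAlgebra.sum_coeff_single q]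
    refine Finset.sum_congr rfl fun k _ => ?_
    rw [LaurentPolynomial.T, AddMonoidAlgebra.smul_single, smul_eq_mul, mul_one]
  refine ⟨q.coeff.support, q.coeff, fun η m ω => ?_, fun z hz => ?_⟩
  · simp_rw [gmIncrement_eq_backwardShift]
    rw [hq, map_mul, Module.End.mul_apply]
    conv_lhs => rw [hsum]
    rw [map_sum, LinearMap.sum_apply, Finset.sum_apply]
    refine Finset.sum_congr rfl fun k _ => ?_
    rw [map_smul, LinearMap.smul_apply, Pi.smul_apply, backwardShift_T, smul_eq_mul]
  · lift z to ℂˣ using hz.isUnit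
    rw [gmSymbol_eq_laurentEval, gmSymbol_eq_laurentEval, hq, map_mul]
    congr 1
    conv_lhs => rw [hsum]
    simp [laurentEval_T]

end BackwardShift

/-! ### The spectral kernels on `[-π, π]` -/

/-- Division of an entire function by finitely many of its zeros. -/
lemma exists_eq_prod_sub_mul {f : ℂ → ℂ} (hf : Differentiable ℂ f) (S : Finset ℂ)
    (hS : ∀ a ∈ S, f a = 0) :
    ∃ g : ℂ → ℂ, Differentiable ℂ g ∧ ∀ z, f z = (∏ a ∈ S, (z - a)) * g z := by
  induction S using Finset.cons_induction with
  | empty => exact ⟨f, hf, by simp⟩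
  | cons a S ha ih =>
    obtain ⟨g, hg, hfg⟩ := ih fun b hb => hS b (Finset.mem_cons_of_mem hb)
    have hga : g a = 0 := by
      have h := hfg a
      rw [hS a (Finset.mem_cons_self a S), eq_comm, mul_eq_zero] at h
      refine h.resolve_left (Finset.prod_ne_zero_iff.2 fun b hb => sub_ne_zero.2 ?_)
      rintro rfl
      exact ha hb
    refine ⟨dslope g a, ?_, fun z => ?_⟩
    · rw [← differentiableOn_univ] at hg ⊢
      exact (Complex.differentiableOn_dslope Filter.univ_mem).2 hg
    · have h := sub_smul_dslope g a z
      rw [hga, sub_zero, smul_eq_mul] at h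
      rw [hfg, ← h, Finset.prod_cons]
      ring

/-- One factor of `χ₁(e^(-iy)) / β(iy)`. All zeros of `1 - e^(-iyn)` are simple, and those in
`[-π, π]` are zeros of the denominator, so that the quotient does not vanish there. -/
lemma exists_continuous_factor (n : ℕ) (hn : 0 < n) :
    ∃ κ : ℝ → ℂ, Continuous κ ∧
      (∀ y : ℝ, 1 - Complex.exp (-(Complex.I * (y : ℂ))) ^ n = κ y *
        ∏ k ∈ Finset.Icc (-((n / 2 : ℕ) : ℤ)) ((n / 2 : ℕ) : ℤ),
          (Complex.I * (y : ℂ) - 2 * (Real.pi : ℂ) * Complex.I * (k : ℂ) / (n : ℂ))) ∧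
      ∀ y ∈ Set.Icc (-Real.pi) Real.pi, κ y ≠ 0 := by
  have hn0 : (n : ℂ) ≠ 0 := Nat.cast_ne_zero.2 hn.ne'
  have hpi : (Real.pi : ℂ) ≠ 0 := Complex.ofReal_ne_zero.2 Real.pi_ne_zero
  set J := Finset.Icc (-((n / 2 : ℕ) : ℤ)) ((n / 2 : ℕ) : ℤ) with hJ
  set a : ℤ → ℂ := fun k => 2 * (Real.pi : ℂ) * (k : ℂ) / (n : ℂ) with ha
  have ha_inj : Function.Injective a := by
    intro k l hkl
    simp only [ha] at hkl
    field_simp at hkl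
    exact_mod_cast hkl
  set f : ℂ → ℂ := fun z => 1 - Complex.exp (-(Complex.I * z * n)) with hf
  have hf' : ∀ z, HasDerivAt f (Complex.I * n * Complex.exp (-(Complex.I * z * n))) z := by
    intro z
    have h := ((((hasDerivAt_id z).const_mul Complex.I).mul_const (n : ℂ)).neg.cexp).const_sub 1
    refine h.congr_deriv ?_
    simp only [id, mul_one, Pi.neg_apply]
    ring
  have hfz : ∀ z, f z = 0 ↔ ∃ k : ℤ, z = a k := by
    intro z
    rw [hf, sub_eq_zero, eq_comm, Complex.exp_eq_one_iff]
    constructor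
    · rintro ⟨k, hk⟩
      refine ⟨-k, ?_⟩
      simp only [ha]
      rw [eq_div_iff hn0]
      refine mul_left_cancel₀ Complex.I_ne_zero ?_
      push_cast
      linear_combination -hk
    · rintro ⟨k, rfl⟩
      refine ⟨-k, ?_⟩
      simp only [ha]
      push_cast
      field_simp
  obtain ⟨g, hg, hfg⟩ := exists_eq_prod_sub_mul (fun z => (hf' z).differentiableAt) (J.image a) (by
    intro z hz
    obtain ⟨k, -, rfl⟩ := Finset.mem_image.1 hz
    exact (hfz _).2 ⟨k, rfl⟩)
  have hprod : ∀ z, ∏ b ∈ J.image a, (z - b) = ∏ k ∈ J, (z - a k) := fun z =>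
    Finset.prod_image fun k _ l _ h => ha_inj h
  simp_rw [hprod] at hfg
  have hI : Complex.I ^ J.card ≠ 0 := pow_ne_zero _ Complex.I_ne_zero
  refine ⟨fun y => g y / Complex.I ^ J.card, ?_, fun y => ?_, fun y hy => ?_⟩
  · exact (hg.continuous.comp Complex.continuous_ofReal).div_const _
  · have h1 : ∏ k ∈ J, (Complex.I * (y : ℂ) - 2 * (Real.pi : ℂ) * Complex.I * (k : ℂ) / (n : ℂ)) =
        Complex.I ^ J.card * ∏ k ∈ J, ((y : ℂ) - a k) := by
      rw [← Finset.prod_const, ← Finset.prod_mul_distrib]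
      refine Finset.prod_congr rfl fun k _ => ?_
      simp only [ha]
      ring
    have h2 : 1 - Complex.exp (-(Complex.I * (y : ℂ))) ^ n = f y := by
      rw [← Complex.exp_nat_mul]
      simp only [hf]
      congr 2
      ring
    rw [h1, h2, hfg]
    field_simp
  · refine div_ne_zero (fun hgy => ?_) hI
    have hfy : f y = 0 := by rw [hfg, hgy, mul_zero]
    obtain ⟨k, hk⟩ := (hfz y).1 hfy
    have hkJ : k ∈ J := by
      have hyk : y * n = 2 * Real.pi * k := by
        have h : (y : ℂ) * n = 2 * Real.pi * k := by
          rw [hk]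
          simp only [ha]
          field_simp
        exact_mod_cast h
      have hnR : (0 : ℝ) < n := Nat.cast_pos.2 hn
      have h1 : 2 * (k : ℝ) ≤ n := by
        have := mul_le_mul_of_nonneg_right hy.2 hnR.le
        nlinarith [Real.pi_pos]
      have h2 : -(n : ℝ) ≤ 2 * k := by
        have := mul_le_mul_of_nonneg_right hy.1 hnR.le
        nlinarith [Real.pi_pos]
      have h1' : 2 * k ≤ n := by exact_mod_cast h1
      have h2' : -(n : ℤ) ≤ 2 * k := by exact_mod_cast h2
      rw [hJ, Finset.mem_Icc]
      omega
    have hB : ∏ k ∈ J, ((y : ℂ) - a k) = 0 :=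
      Finset.prod_eq_zero hkJ (by rw [hk, sub_self])
    -- otherwise `y` would be a zero of order at least two
    have hBd : Differentiable ℂ fun z : ℂ => ∏ k ∈ J, (z - a k) := by fun_prop
    have h := ((hBd y).hasDerivAt.mul (hg y).hasDerivAt)
    rw [hB, hgy, mul_zero, zero_mul, add_zero] at h
    have h' := (hf' y).unique (h.congr_of_eventuallyEq (Eventually.of_forall hfg))
    exact mul_ne_zero (mul_ne_zero Complex.I_ne_zero hn0) (Complex.exp_ne_zero _) h'

/-- The quotient `χ₁(e^(-iy)) / β(iy)` for unit steps extends to a continuous function without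
zeros in `[-π, π]`. -/
lemma exists_continuous_quotient {r : ℕ} (s d : Fin r → ℕ) (hs : ∀ i, 0 < s i) :
    ∃ κ : ℝ → ℂ, Continuous κ ∧
      (∀ y : ℝ, gmSymbol s d 1 (Complex.exp (-(Complex.I * (y : ℂ)))) = κ y * gmBeta s d y) ∧
      ∀ y ∈ Set.Icc (-Real.pi) Real.pi, κ y ≠ 0 := by
  choose κ hc hκ h0 using fun j => exists_continuous_factor (s j) (hs j)
  refine ⟨fun y => ∏ j, κ j y ^ d j, by fun_prop, fun y => ?_, fun y hy => ?_⟩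
  · rw [gmSymbol, gmBeta, ← Finset.prod_mul_distrib]
    refine Finset.prod_congr rfl fun j _ => ?_
    rw [Finset.prod_pow, ← mul_pow, ← hκ]
    simp
  · exact Finset.prod_ne_zero_iff.2 fun j _ => pow_ne_zero _ (h0 j y hy)

lemma eventually_gmBeta_ne_zero {r : ℕ} (s d : Fin r → ℕ) (x : ℝ) :
    ∀ᶠ y in 𝓝[≠] x, gmBeta s d y ≠ 0 := by
  simp only [gmBeta, Finset.prod_ne_zero_iff]
  rw [Filter.eventually_all]
  intro j
  simp only [Finset.mem_univ, true_imp_iff]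
  rw [Filter.eventually_all_finset]
  intro k _
  have h : ∀ᶠ y : ℝ in 𝓝[≠] x, y ≠ 2 * Real.pi * k / s j := by
    rcases eq_or_ne x (2 * Real.pi * k / s j) with hx | hx
    · exact hx ▸ self_mem_nhdsWithin
    · exact nhdsWithin_le_nhds (isOpen_ne.mem_nhds hx)
  filter_upwards [h] with y hy
  refine pow_ne_zero _ fun h0 => hy ?_
  have h1 : Complex.I * ((y : ℂ) - 2 * Real.pi * k / s j) = 0 := by
    linear_combination h0
  have h2 := sub_eq_zero.1 ((mul_eq_zero.1 h1).resolve_left Complex.I_ne_zero)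
  exact_mod_cast h2

lemma contExt_eq {f g : ℝ → ℂ} {x : ℝ} (hg : ContinuousAt g x) (h : ∀ᶠ y in 𝓝[≠] x, f y = g y) :
    contExt f x = g x :=
  ((hg.tendsto.mono_left nhdsWithin_le_nhds).congr' (h.mono fun _ hy => hy.symm)).limUnder_eq

lemma conj_gmSymbol {r : ℕ} (s d : Fin r → ℕ) (μ : Fin r → ℤ) (z : ℂ) :
    conj (gmSymbol s d μ z) = gmSymbol s d μ (conj z) := by
  simp [gmSymbol]

lemma conj_exp_neg_I_mul (y : ℝ) :
    conj (Complex.exp (-(Complex.I * (y : ℂ)))) = Complex.exp (Complex.I * (y : ℂ)) := by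
  rw [← Complex.exp_conj]
  simp

section Kernels

variable {r : ℕ} {s d : Fin r → ℕ} {κ : ℝ → ℂ}

lemma spectralKernel_eq (hκ : Continuous κ)
    (hκβ : ∀ y : ℝ, gmSymbol s d 1 (Complex.exp (-(Complex.I * (y : ℂ)))) = κ y * gmBeta s d y)
    {μ : Fin r → ℤ} {Q : ℂ → ℂ} (hQ : ContinuousOn Q {0}ᶜ)
    (hμ : ∀ z : ℂ, z ≠ 0 → gmSymbol s d μ z = Q z * gmSymbol s d 1 z) (m : ℤ) (x : ℝ) :
    spectralKernel s d μ m x = Complex.exp (Complex.I * (m : ℂ) * (x : ℂ)) *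
      (Q (Complex.exp (-(Complex.I * (x : ℂ)))) * κ x) := by
  have hQc : Continuous fun y : ℝ => Q (Complex.exp (-(Complex.I * (y : ℂ)))) :=
    hQ.comp_continuous (by fun_prop) fun y => Complex.exp_ne_zero _
  rw [spectralKernel, contExt_eq (g := fun y : ℝ => Q (Complex.exp (-(Complex.I * (y : ℂ)))) * κ y)
    (hQc.mul hκ).continuousAt]
  filter_upwards [eventually_gmBeta_ne_zero s d x] with y hy
  rw [hμ _ (Complex.exp_ne_zero _), hκβ, ← mul_assoc, mul_div_assoc, div_self hy, mul_one]

lemma structuralKernel_eq (hκ : Continuous κ)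
    (hκβ : ∀ y : ℝ, gmSymbol s d 1 (Complex.exp (-(Complex.I * (y : ℂ)))) = κ y * gmBeta s d y)
    {μ₁ μ₂ : Fin r → ℤ} {Q₁ Q₂ : ℂ → ℂ} (hQ₁ : ContinuousOn Q₁ {0}ᶜ) (hQ₂ : ContinuousOn Q₂ {0}ᶜ)
    (hμ₁ : ∀ z : ℂ, z ≠ 0 → gmSymbol s d μ₁ z = Q₁ z * gmSymbol s d 1 z)
    (hμ₂ : ∀ z : ℂ, z ≠ 0 → gmSymbol s d μ₂ z = Q₂ z * gmSymbol s d 1 z) (m : ℤ) (x : ℝ) :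
    structuralKernel s d μ₁ μ₂ m x = Complex.exp (Complex.I * (m : ℂ) * (x : ℂ)) *
      ((Q₁ (Complex.exp (-(Complex.I * (x : ℂ)))) * κ x) *
        conj (Q₂ (Complex.exp (-(Complex.I * (x : ℂ)))) * κ x)) := by
  have hc₁ : Continuous fun y : ℝ => Q₁ (Complex.exp (-(Complex.I * (y : ℂ)))) :=
    hQ₁.comp_continuous (by fun_prop) fun y => Complex.exp_ne_zero _
  have hc₂ : Continuous fun y : ℝ => Q₂ (Complex.exp (-(Complex.I * (y : ℂ)))) :=
    hQ₂.comp_continuous (by fun_prop) fun y => Complex.exp_ne_zero _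
  rw [structuralKernel, contExt_eq (g := fun y : ℝ =>
    (Q₁ (Complex.exp (-(Complex.I * (y : ℂ)))) * κ y) *
        conj (Q₂ (Complex.exp (-(Complex.I * (y : ℂ)))) * κ y))
    ((hc₁.mul hκ).mul (Complex.continuous_conj.comp (hc₂.mul hκ))).continuousAt]
  filter_upwards [eventually_gmBeta_ne_zero s d x] with y hy
  have hy' : conj (gmBeta s d y) ≠ 0 := (map_ne_zero _).2 hy
  rw [← conj_exp_neg_I_mul, ← conj_gmSymbol, hμ₁ _ (Complex.exp_ne_zero _),
    hμ₂ _ (Complex.exp_ne_zero _), hκβ, Complex.ofReal_pow, ← Complex.mul_conj']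
  simp only [map_mul]
  field_simp

end Kernels

/-! ### Functions of the principal argument in `L²` of the circle -/

instance fact_two_pi_pos : Fact (0 < 2 * Real.pi) := ⟨Real.two_pi_pos⟩

/-- The circle `ℝ / 2πℤ`. -/
abbrev Torus : Type := AddCircle (2 * Real.pi)

/-- The representative in `[-π, π)` of a point of the circle. -/
noncomputable def torusArg (x : Torus) : ℝ := (AddCircle.equivIco (2 * Real.pi) (-Real.pi) x : ℝ)

lemma torusArg_mem (x : Torus) : torusArg x ∈ Set.Ico (-Real.pi) Real.pi := by
  have h := (AddCircle.equivIco (2 * Real.pi) (-Real.pi) x).2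
  exact ⟨h.1, h.2.trans_eq (by ring)⟩

lemma torusArg_mem_Icc (x : Torus) : torusArg x ∈ Set.Icc (-Real.pi) Real.pi :=
  Set.Ico_subset_Icc_self (torusArg_mem x)

lemma coe_torusArg (x : Torus) : ((torusArg x : ℝ) : Torus) = x :=
  AddCircle.coe_equivIco

lemma torusArg_coe {y : ℝ} (hy : y ∈ Set.Ico (-Real.pi) Real.pi) : torusArg (y : Torus) = y :=
  AddCircle.equivIco_coe_of_mem ⟨hy.1, hy.2.trans_eq (by ring)⟩

lemma measurable_torusArg : Measurable torusArg :=
  measurable_subtype_coe.comp (AddCircle.measurableEquivIco (2 * Real.pi) (-Real.pi)).measurable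

/-- The character `x ↦ e^(imx)`. -/
noncomputable def expChar (m : ℤ) (x : ℝ) : ℂ := Complex.exp (Complex.I * (m : ℂ) * (x : ℂ))

lemma continuous_expChar (m : ℤ) : Continuous (expChar m) := by
  unfold expChar
  fun_prop

lemma expChar_add (m n : ℤ) (x : ℝ) : expChar (m + n) x = expChar m x * expChar n x := by
  rw [expChar, expChar, expChar, ← Complex.exp_add]
  push_cast
  ring_nf

lemma conj_expChar (m : ℤ) (x : ℝ) : conj (expChar m x) = expChar (-m) x := by
  rw [expChar, expChar, ← Complex.exp_conj]
  simp

lemma norm_expChar (m : ℤ) (x : ℝ) : ‖expChar m x‖ = 1 := by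
  rw [expChar, show Complex.I * (m : ℂ) * (x : ℂ) = ((m * x : ℝ) : ℂ) * Complex.I by
    push_cast; ring]
  exact Complex.norm_exp_ofReal_mul_I _

lemma fourier_eq_expChar (m : ℤ) (x : Torus) : fourier m x = expChar m (torusArg x) := by
  conv_lhs => rw [← coe_torusArg x]
  rw [fourier_coe_apply, expChar]
  congr 1
  have : (Real.pi : ℂ) ≠ 0 := Complex.ofReal_ne_zero.2 Real.pi_ne_zero
  push_cast
  field_simp

/-- Measurable functions bounded on `[-π, π)`. -/
structure IsBoundedOnPeriod (f : ℝ → ℂ) : Prop where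
  measurable : Measurable f
  bounded : ∃ C, 0 ≤ C ∧ ∀ x ∈ Set.Ico (-Real.pi) Real.pi, ‖f x‖ ≤ C

namespace IsBoundedOnPeriod

variable {f g : ℝ → ℂ}

lemma of_continuousOn (hf : Measurable f) (hc : ContinuousOn f (Set.Icc (-Real.pi) Real.pi)) :
    IsBoundedOnPeriod f := by
  obtain ⟨C, hC⟩ := isCompact_Icc.exists_bound_of_continuousOn hc
  exact ⟨hf, max C 0, le_max_right _ _, fun x hx =>
    (hC x (Set.Ico_subset_Icc_self hx)).trans (le_max_left _ _)⟩

lemma of_continuous (hf : Continuous f) : IsBoundedOnPeriod f :=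
  of_continuousOn hf.measurable hf.continuousOn

lemma expChar (m : ℤ) : IsBoundedOnPeriod (expChar m) := of_continuous (continuous_expChar m)

lemma add (hf : IsBoundedOnPeriod f) (hg : IsBoundedOnPeriod g) : IsBoundedOnPeriod (f + g) := by
  obtain ⟨C, hC0, hC⟩ := hf.bounded
  obtain ⟨D, hD0, hD⟩ := hg.bounded
  exact ⟨hf.measurable.add hg.measurable, C + D, add_nonneg hC0 hD0, fun x hx =>
    norm_add_le_of_le (hC x hx) (hD x hx)⟩

lemma mul (hf : IsBoundedOnPeriod f) (hg : IsBoundedOnPeriod g) : IsBoundedOnPeriod (f * g) := by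
  obtain ⟨C, hC0, hC⟩ := hf.bounded
  obtain ⟨D, hD0, hD⟩ := hg.bounded
  exact ⟨hf.measurable.mul hg.measurable, C * D, mul_nonneg hC0 hD0, fun x hx =>
    norm_mul_le_of_le (hC x hx) (hD x hx)⟩

lemma const_smul (c : ℂ) (hf : IsBoundedOnPeriod f) : IsBoundedOnPeriod (c • f) := by
  obtain ⟨C, hC0, hC⟩ := hf.bounded
  refine ⟨hf.measurable.const_smul c, ‖c‖ * C, by positivity, fun x hx => ?_⟩
  rw [Pi.smul_apply, norm_smul]
  exact mul_le_mul_of_nonneg_left (hC x hx) (norm_nonneg _)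

lemma sub (hf : IsBoundedOnPeriod f) (hg : IsBoundedOnPeriod g) : IsBoundedOnPeriod (f - g) := by
  have h := hf.add (hg.const_smul (-1))
  rwa [neg_one_smul, ← sub_eq_add_neg] at h

lemma sum {ι : Type*} {S : Finset ι} {f : ι → ℝ → ℂ} (hf : ∀ i ∈ S, IsBoundedOnPeriod (f i)) :
    IsBoundedOnPeriod (∑ i ∈ S, f i) :=
  Finset.sum_induction f IsBoundedOnPeriod (fun _ _ => add)
    (of_continuous (by exact continuous_const)) hf

lemma indicator (hf : IsBoundedOnPeriod f) {A : Set ℝ} (hA : MeasurableSet A) :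
    IsBoundedOnPeriod (A.indicator f) := by
  obtain ⟨C, hC0, hC⟩ := hf.bounded
  exact ⟨hf.measurable.indicator hA, C, hC0, fun x hx =>
    (norm_indicator_le_norm_self f x).trans (hC x hx)⟩

lemma star (hf : IsBoundedOnPeriod f) : IsBoundedOnPeriod fun x => conj (f x) := by
  obtain ⟨C, hC0, hC⟩ := hf.bounded
  exact ⟨Complex.continuous_conj.measurable.comp hf.measurable, C, hC0, fun x hx => by
    rw [RCLike.norm_conj]; exact hC x hx⟩

lemma memLp (hf : IsBoundedOnPeriod f) (σ : Measure Torus) [IsFiniteMeasure σ] :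
    MemLp (fun x => f (torusArg x)) 2 σ := by
  obtain ⟨C, -, hC⟩ := hf.bounded
  exact MemLp.of_bound (hf.measurable.comp measurable_torusArg).aestronglyMeasurable C
    (Eventually.of_forall fun x => hC _ (torusArg_mem x))

end IsBoundedOnPeriod

section PeriodLp

variable (σ : Measure Torus) [IsFiniteMeasure σ] {f g : ℝ → ℂ}

open Classical in
/-- The class in `L²(σ)` of the function on the circle that agrees with `f` on `[-π, π)`; zero if
that function is not square integrable. -/
noncomputable def periodLp (f : ℝ → ℂ) : Lp ℂ 2 σ :=
  if h : MemLp (fun x => f (torusArg x)) 2 σ then h.toLp _ else 0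

variable {σ}

lemma periodLp_eq (hf : IsBoundedOnPeriod f) : periodLp σ f = (hf.memLp σ).toLp _ :=
  dif_pos (hf.memLp σ)

lemma coeFn_periodLp (hf : IsBoundedOnPeriod f) :
    periodLp σ f =ᵐ[σ] fun x => f (torusArg x) := by
  rw [periodLp_eq hf]
  exact MemLp.coeFn_toLp _

omit [IsFiniteMeasure σ] in
lemma periodLp_congr (h : ∀ x ∈ Set.Ico (-Real.pi) Real.pi, f x = g x) :
    periodLp σ f = periodLp σ g := by
  have h' : (fun x => f (torusArg x)) = fun x => g (torusArg x) :=
    funext fun x => h _ (torusArg_mem x)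
  unfold periodLp
  rw [h']

lemma periodLp_add (hf : IsBoundedOnPeriod f) (hg : IsBoundedOnPeriod g) :
    periodLp σ (f + g) = periodLp σ f + periodLp σ g := by
  rw [periodLp_eq hf, periodLp_eq hg, periodLp_eq (hf.add hg)]
  rfl

lemma periodLp_smul (c : ℂ) (hf : IsBoundedOnPeriod f) :
    periodLp σ (c • f) = c • periodLp σ f := by
  rw [periodLp_eq hf, periodLp_eq (hf.const_smul c)]
  rfl

lemma periodLp_sub (hf : IsBoundedOnPeriod f) (hg : IsBoundedOnPeriod g) :
    periodLp σ (f - g) = periodLp σ f - periodLp σ g := by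
  rw [periodLp_eq hf, periodLp_eq hg, periodLp_eq (hf.sub hg)]
  rfl

lemma periodLp_sum {ι : Type*} {S : Finset ι} {f : ι → ℝ → ℂ}
    (hf : ∀ i ∈ S, IsBoundedOnPeriod (f i)) :
    periodLp σ (∑ i ∈ S, f i) = ∑ i ∈ S, periodLp σ (f i) := by
  induction S using Finset.cons_induction with
  | empty =>
    have h0 : periodLp σ ((0 : ℂ) • (0 : ℝ → ℂ)) = (0 : ℂ) • periodLp σ 0 :=
      periodLp_smul 0 (.of_continuous (by exact continuous_const))
    simpa using h0
  | cons a S ha ih =>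
    rw [Finset.sum_cons, Finset.sum_cons, periodLp_add (hf a (Finset.mem_cons_self a S))
      (.sum fun i hi => hf i (Finset.mem_cons_of_mem hi)),
      ih fun i hi => hf i (Finset.mem_cons_of_mem hi)]

lemma norm_periodLp_mul_le {C : ℝ} (hf : IsBoundedOnPeriod f) (hg : IsBoundedOnPeriod g)
    (hC : ∀ x ∈ Set.Ico (-Real.pi) Real.pi, ‖f x‖ ≤ C) :
    ‖periodLp σ (f * g)‖ ≤ C * ‖periodLp σ g‖ := by
  refine Lp.norm_le_mul_norm_of_ae_le_mul ?_
  filter_upwards [coeFn_periodLp (σ := σ) hg, coeFn_periodLp (σ := σ) (hf.mul hg)] with x h₁ h₂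
  rw [h₁, h₂, Pi.mul_apply, norm_mul]
  exact mul_le_mul_of_nonneg_right (hC _ (torusArg_mem x)) (norm_nonneg _)

lemma norm_periodLp_conj (hf : IsBoundedOnPeriod f) :
    ‖periodLp σ fun x => conj (f x)‖ = ‖periodLp σ f‖ := by
  refine le_antisymm (Lp.norm_le_norm_of_ae_le ?_) (Lp.norm_le_norm_of_ae_le ?_) <;>
  · filter_upwards [coeFn_periodLp (σ := σ) hf, coeFn_periodLp (σ := σ) hf.star] with x h₁ h₂
    rw [h₁, h₂, RCLike.norm_conj]

lemma norm_periodLp_le {C : ℝ} (hf : IsBoundedOnPeriod f)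
    (hC : ∀ x ∈ Set.Ico (-Real.pi) Real.pi, ‖f x‖ ≤ C) :
    ‖periodLp σ f‖ ≤ C * ‖periodLp σ (expChar 0)‖ := by
  have h := norm_periodLp_mul_le (σ := σ) hf (.expChar 0) hC
  rwa [show f * expChar 0 = f by ext x; simp [expChar]] at h

/-- Bounded convergence in `L²(σ)`. -/
lemma tendsto_periodLp {ι : Type*} {l : Filter ι} [l.IsCountablyGenerated] {F : ι → ℝ → ℂ} {C : ℝ}
    (hF : ∀ i, IsBoundedOnPeriod (F i)) (hf : IsBoundedOnPeriod f)
    (hC : ∀ i, ∀ x ∈ Set.Ico (-Real.pi) Real.pi, ‖F i x‖ ≤ C)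
    (hlim : ∀ x ∈ Set.Ico (-Real.pi) Real.pi, Tendsto (fun i => F i x) l (𝓝 (f x))) :
    Tendsto (fun i => periodLp σ (F i)) l (𝓝 (periodLp σ f)) := by
  rw [tendsto_iff_norm_sub_tendsto_zero]
  have hnorm : ∀ i, ‖periodLp σ (F i) - periodLp σ f‖ ^ 2 =
      ∫ x, ‖F i (torusArg x) - f (torusArg x)‖ ^ 2 ∂σ := by
    intro i
    rw [← periodLp_sub (hF i) hf, ← inner_self_eq_norm_sq (𝕜 := ℂ), L2.inner_def,
      ← integral_re (by exact L2.integrable_inner _ _)]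
    refine integral_congr_ae ?_
    filter_upwards [coeFn_periodLp (σ := σ) ((hF i).sub hf)] with x hx
    rw [hx, inner_self_eq_norm_sq]
    rfl
  have h2 : Tendsto (fun i => ‖periodLp σ (F i) - periodLp σ f‖ ^ 2) l (𝓝 0) := by
    simp_rw [hnorm]
    rw [show (0 : ℝ) = ∫ _ : Torus, (0 : ℝ) ∂σ by simp]
    obtain ⟨D, hD0, hD⟩ := hf.bounded
    refine tendsto_integral_filter_of_dominated_convergence (fun _ => (C + D) ^ 2)
      (Eventually.of_forall fun i => ?_) (Eventually.of_forall fun i => ?_)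
      (integrable_const _) (Eventually.of_forall fun x => ?_)
    · exact ((((hF i).measurable.sub hf.measurable).comp
        measurable_torusArg).norm.pow_const 2).aestronglyMeasurable
    · refine Eventually.of_forall fun x => ?_
      rw [Real.norm_of_nonneg (by positivity)]
      gcongr
      exact norm_sub_le_of_le (hC i _ (torusArg_mem x)) (hD _ (torusArg_mem x))
    · have h := ((hlim _ (torusArg_mem x)).sub_const (f (torusArg x))).norm.pow 2
      simpa using h
  have h3 := h2.sqrt
  simpa using h3

end PeriodLp

/-- If the increments of `G` are the images of the functions `1_[a, b) h` under a continuous linear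
map `Φ` on `L²(σ)`, then the Riemann–Stieltjes integral of a continuous `f` with respect to `G` is
the image of `f h`: the Riemann–Stieltjes sums are images of step functions that approximate `f h`
uniformly. -/
theorem hasRSIntegral_of_increments {E : Type*} [NormedAddCommGroup E] [NormedSpace ℂ E]
    {σ : Measure Torus} [IsFiniteMeasure σ] (Φ : Lp ℂ 2 σ →L[ℂ] E) {G : ℝ → E} {f h : ℝ → ℂ}
    (hh : IsBoundedOnPeriod h) (hf : Continuous f)
    (hG : ∀ a b, -Real.pi ≤ a → a ≤ b → b ≤ Real.pi →
      G b - G a = Φ (periodLp σ ((Set.Ico a b).indicator h))) :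
    HasRSIntegral f G (-Real.pi) Real.pi (Φ (periodLp σ (f * h))) := by
  intro ε hε
  obtain ⟨C, hC0, hC⟩ := hh.bounded
  set K : ℝ := ‖Φ‖ * (C * ‖periodLp σ (expChar 0)‖) with hK
  have hK0 : 0 ≤ K := by positivity
  have huc := isCompact_Icc.uniformContinuousOn_of_continuous
    (s := Set.Icc (-Real.pi) Real.pi) hf.continuousOn
  rw [Metric.uniformContinuousOn_iff] at huc
  obtain ⟨δ, hδ, hfδ⟩ := huc (ε / (K + 1)) (by positivity)
  refine ⟨δ, hδ, fun n t τ ht0 htn ht => ?_⟩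
  have hmono : ∀ i ≤ n, ∀ j ≤ i, t j ≤ t i := by
    intro i
    induction i with
    | zero => intro _ j hj; rw [Nat.le_zero.1 hj]
    | succ i ih =>
      intro hi j hj
      rcases hj.eq_or_lt with rfl | hj
      · rfl
      · exact (ih (by omega) j (by omega)).trans ((ht i (by omega)).1.trans (ht i (by omega)).2.1)
  have hlo : ∀ i ≤ n, -Real.pi ≤ t i := fun i hi => ht0 ▸ hmono i hi 0 (Nat.zero_le i)
  have hhi : ∀ i ≤ n, t i ≤ Real.pi := fun i hi => htn ▸ hmono n le_rfl i hi
  have hbi : ∀ i, IsBoundedOnPeriod ((Set.Ico (t i) (t (i + 1))).indicator h) := fun i =>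
    hh.indicator measurableSet_Ico
  have hfh : IsBoundedOnPeriod (f * h) := (IsBoundedOnPeriod.of_continuous hf).mul hh
  have hbs : IsBoundedOnPeriod
      (∑ i ∈ Finset.range n, f (τ i) • (Set.Ico (t i) (t (i + 1))).indicator h) :=
    .sum fun i _ => (hbi i).const_smul _
  have hsum : ∑ i ∈ Finset.range n, f (τ i) • (G (t (i + 1)) - G (t i)) - Φ (periodLp σ (f * h)) =
      Φ (periodLp σ ((∑ i ∈ Finset.range n,
        f (τ i) • (Set.Ico (t i) (t (i + 1))).indicator h) - f * h)) := by
    rw [periodLp_sub hbs hfh, map_sub, periodLp_sum fun i _ => (hbi i).const_smul _, map_sum]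
    congr 1
    refine Finset.sum_congr rfl fun i hi => ?_
    have hi' := Finset.mem_range.1 hi
    rw [hG _ _ (hlo i hi'.le) ((ht i hi').1.trans (ht i hi').2.1) (hhi (i + 1) hi'),
      periodLp_smul _ (hbi i), map_smul]
  -- the cells `[t i, t (i + 1))` partition `[-π, π)`
  have hpart : ∀ x ∈ Set.Ico (-Real.pi) Real.pi,
      ∑ i ∈ Finset.range n, (Set.Ico (t i) (t (i + 1))).indicator (fun _ => (1 : ℝ)) x = 1 := by
    intro x hx
    have h1 : ∀ i ∈ Finset.range n, (Set.Ico (t i) (t (i + 1))).indicator (fun _ => (1 : ℝ)) x =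
        (Set.Iio (t (i + 1))).indicator (fun _ => (1 : ℝ)) x -
          (Set.Iio (t i)).indicator (fun _ => (1 : ℝ)) x := by
      intro i hi
      have hle := hmono (i + 1) (Finset.mem_range.1 hi) i (Nat.le_succ i)
      rcases lt_or_ge x (t i) with h | h
      · simp [h, h.trans_le hle]
      · rcases lt_or_ge x (t (i + 1)) with h' | h' <;> simp [h, h']
    rw [Finset.sum_congr rfl h1, Finset.sum_range_sub
      (fun i => (Set.Iio (t i)).indicator (fun _ => (1 : ℝ)) x), ht0, htn,
      Set.indicator_of_mem (Set.mem_Iio.2 hx.2), Set.indicator_of_notMem (by simpa using hx.1),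
      sub_zero]
  have hbound : ∀ x ∈ Set.Ico (-Real.pi) Real.pi, ‖((∑ i ∈ Finset.range n,
      f (τ i) • (Set.Ico (t i) (t (i + 1))).indicator h) - f * h) x‖ ≤ ε / (K + 1) * C := by
    intro x hx
    have h1 : ((∑ i ∈ Finset.range n,
        f (τ i) • (Set.Ico (t i) (t (i + 1))).indicator h) - f * h) x =
        ∑ i ∈ Finset.range n, (((Set.Ico (t i) (t (i + 1))).indicator (fun _ => (1 : ℝ)) x : ℝ) : ℂ)
          * ((f (τ i) - f x) * h x) := by
      have h2 : (f * h) x = ∑ i ∈ Finset.range n,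
          (((Set.Ico (t i) (t (i + 1))).indicator (fun _ => (1 : ℝ)) x : ℝ) : ℂ) * (f x * h x) := by
        rw [← Finset.sum_mul, ← Complex.ofReal_sum, hpart x hx, Complex.ofReal_one, one_mul,
          Pi.mul_apply]
      rw [Pi.sub_apply, h2, Finset.sum_apply, ← Finset.sum_sub_distrib]
      refine Finset.sum_congr rfl fun i _ => ?_
      by_cases hxi : x ∈ Set.Ico (t i) (t (i + 1))
      · simp [hxi, sub_mul]
      · simp [hxi]
    rw [h1]
    calc _ ≤ ∑ i ∈ Finset.range n, (Set.Ico (t i) (t (i + 1))).indicator (fun _ => (1 : ℝ)) x *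
          (ε / (K + 1) * C) := by
          refine norm_sum_le_of_le _ fun i hi => ?_
          have hi' := Finset.mem_range.1 hi
          by_cases hxi : x ∈ Set.Ico (t i) (t (i + 1))
          · rw [Set.indicator_of_mem hxi, Complex.ofReal_one, one_mul, one_mul, norm_mul]
            refine mul_le_mul ?_ (hC x hx) (norm_nonneg _) (by positivity)
            rw [← dist_eq_norm]
            obtain ⟨h3, h4, h5⟩ := ht i hi'
            refine (hfδ _ ⟨(hlo i hi'.le).trans h3, h4.trans (hhi (i + 1) hi')⟩ _
              (Set.Ico_subset_Icc_self hx) ?_).le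
            rw [Real.dist_eq, abs_lt]
            constructor <;> linarith [hxi.1, hxi.2]
          · simp [hxi]
      _ = ε / (K + 1) * C := by rw [← Finset.sum_mul, hpart x hx, one_mul]
  rw [hsum]
  calc _ ≤ ‖Φ‖ * (ε / (K + 1) * C * ‖periodLp σ (expChar 0)‖) :=
        (Φ.le_opNorm _).trans (mul_le_mul_of_nonneg_left
          (norm_periodLp_le (hbs.sub hfh) hbound) (norm_nonneg _))
    _ = ε * (K / (K + 1)) := by rw [hK]; ring
    _ < ε * 1 := by
        refine mul_lt_mul_of_pos_left ?_ hε
        rw [div_lt_one (by positivity)]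
        linarith
    _ = ε := mul_one ε

/-! ### Herglotz's theorem -/

lemma integral_fourier (m : ℤ) :
    ∫ x, fourier m x ∂(AddCircle.haarAddCircle (T := 2 * Real.pi)) = if m = 0 then 1 else 0 := by
  have h := fourierCoeff_fourier (T := 2 * Real.pi) m
  have h0 := congrFun h 0
  simp only [fourierCoeff, neg_zero, fourier_zero, one_smul] at h0
  rw [h0]
  simp [Pi.single_apply, eq_comm]

/-- The Fejér mean `N⁻¹ ∑ₖ ∑ₗ R(k - l) e^(-i(k-l)x)`, `0 ≤ k, l < N`. -/
noncomputable def fejerMean (R : ℤ → ℂ) (N : ℕ) : C(Torus, ℂ) :=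
  ((N : ℂ)⁻¹) • ∑ k ∈ Finset.Ico (0 : ℤ) N, ∑ l ∈ Finset.Ico (0 : ℤ) N, R (k - l) • fourier (l - k)

lemma integral_fourier_mul_fejerMean (R : ℤ → ℂ) (N : ℕ) (m : ℤ) :
    ∫ x, fourier m x * fejerMean R N x ∂(AddCircle.haarAddCircle (T := 2 * Real.pi)) =
      ((N : ℂ)⁻¹ * ((N - m.natAbs : ℕ) : ℂ)) * R m := by
  have h1 : ∀ x : Torus, fourier m x * fejerMean R N x = (N : ℂ)⁻¹ *
      ∑ k ∈ Finset.Ico (0 : ℤ) N, ∑ l ∈ Finset.Ico (0 : ℤ) N,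
        R (k - l) * fourier (m + (l - k)) x := by
    intro x
    simp only [fejerMean, ContinuousMap.smul_apply, ContinuousMap.sum_apply, smul_eq_mul,
      Finset.mul_sum, fourier_add]
    refine Finset.sum_congr rfl fun k _ => Finset.sum_congr rfl fun l _ => ?_
    ring
  have hint : ∀ n : ℤ, Integrable (fun x => fourier n x)
      (AddCircle.haarAddCircle (T := 2 * Real.pi)) := fun n =>
    (fourier n).continuous.integrable_of_hasCompactSupport (HasCompactSupport.of_compactSpace _)
  simp_rw [h1]
  rw [integral_const_mul, integral_finsetSum _ fun k _ => integrable_finsetSum _ fun l _ =>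
    (hint _).const_mul _]
  simp_rw [integral_finsetSum _ fun l _ => (hint _).const_mul _, integral_const_mul,
    integral_fourier]
  rw [Finset.sum_comm, mul_assoc]
  congr 1
  have h2 : ∀ l ∈ Finset.Ico (0 : ℤ) N, ∑ k ∈ Finset.Ico (0 : ℤ) N,
      R (k - l) * (if m + (l - k) = 0 then 1 else 0) =
      if l ∈ Finset.Ico (max 0 (-m)) (min (N : ℤ) (N - m)) then R m else 0 := by
    intro l hl
    rw [Finset.mem_Ico] at hl
    by_cases h : m + l ∈ Finset.Ico (0 : ℤ) N
    · rw [Finset.sum_eq_single_of_mem _ h fun k _ hk => by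
        rw [if_neg (by omega), mul_zero]]
      rw [Finset.mem_Ico] at h
      rw [if_pos (by ring), if_pos (by rw [Finset.mem_Ico]; omega), mul_one,
        add_sub_cancel_right]
    · rw [if_neg (by rw [Finset.mem_Ico] at h ⊢; omega)]
      refine Finset.sum_eq_zero fun k hk => ?_
      rw [if_neg (fun h0 => h (by rwa [show m + l = k by omega])), mul_zero]
  rw [Finset.sum_congr rfl h2, Finset.sum_ite_mem, Finset.sum_const, nsmul_eq_mul]
  congr 2
  rw [Finset.inter_eq_right.2 (Finset.Ico_subset_Ico (le_max_left _ _) (min_le_left _ _)),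
    Int.card_Ico]
  omega

/-- Herglotz's theorem: a positive definite function on `ℤ` is the sequence of Fourier
coefficients of a finite measure on the circle. The measure is a weak limit of measures whose
densities are the Fejér means. -/
theorem exists_measure_integral_fourier {R : ℤ → ℂ}
    (hR : ∀ (S : Finset ℤ) (c : ℤ → ℂ), 0 ≤ ∑ k ∈ S, ∑ l ∈ S, c k * conj (c l) * R (k - l)) :
    ∃ σ : Measure Torus, IsFiniteMeasure σ ∧ ∀ m, ∫ x, fourier m x ∂σ = R m := by
  set haar := AddCircle.haarAddCircle (T := 2 * Real.pi)
  have hpos : ∀ N x, 0 ≤ fejerMean R N x := by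
    intro N x
    have h := hR (Finset.Ico (0 : ℤ) N) fun k => fourier (-k) x
    simp only [fejerMean, ContinuousMap.smul_apply, ContinuousMap.sum_apply, smul_eq_mul]
    refine mul_nonneg (by positivity) (h.trans_eq ?_)
    refine Finset.sum_congr rfl fun k _ => Finset.sum_congr rfl fun l _ => ?_
    rw [fourier_neg, fourier_neg, Complex.conj_conj, ← fourier_neg, ← fourier_add, mul_comm,
      neg_add_eq_sub]
  have hre : ∀ N x, ((fejerMean R N x).re : ℂ) = fejerMean R N x := fun N x =>
    (Complex.eq_re_of_ofReal_le (r := 0) (by simpa using hpos N x)).symm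
  have hcont : ∀ N, Continuous fun x => (fejerMean R N x).re := fun N =>
    Complex.continuous_re.comp (fejerMean R N).continuous
  let ν : ℕ → Measure Torus := fun N =>
    haar.withDensity fun x => ENNReal.ofReal (fejerMean R N x).re
  have hνfin : ∀ N, IsFiniteMeasure (ν N) := fun N =>
    isFiniteMeasure_withDensity_ofReal
      (((hcont N).integrable_of_hasCompactSupport (HasCompactSupport.of_compactSpace _)).2)
  have hν : ∀ N m, ∫ x, fourier m x ∂(ν N) = ((N : ℂ)⁻¹ * ((N - m.natAbs : ℕ) : ℂ)) * R m := by
    intro N m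
    rw [← integral_fourier_mul_fejerMean]
    rw [integral_withDensity_eq_integral_toReal_smul (hcont N).measurable.ennreal_ofReal
      (Eventually.of_forall fun _ => ENNReal.ofReal_lt_top)]
    refine integral_congr_ae (Eventually.of_forall fun x => ?_)
    have h0 : 0 ≤ (fejerMean R N x).re := (Complex.le_def.1 (hpos N x)).1
    simp only
    rw [ENNReal.toReal_ofReal h0, Complex.real_smul, hre, mul_comm]
  let μ : ℕ → FiniteMeasure Torus := fun N => ⟨ν N, hνfin N⟩
  have hmass : ∀ N, (μ N).mass ≤ ‖R 0‖₊ := by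
    intro N
    have h0 := hν N 0
    simp only [fourier_zero, integral_const, Int.natAbs_zero, Nat.sub_zero] at h0
    rw [Complex.real_smul, mul_one] at h0
    have h1 : ‖((ν N).real Set.univ : ℂ)‖ ≤ ‖R 0‖ := by
      rw [h0, norm_mul]
      refine mul_le_of_le_one_left (norm_nonneg _) ?_
      rcases Nat.eq_zero_or_pos N with rfl | hN
      · simp
      · rw [inv_mul_cancel₀ (by positivity), norm_one]
    rw [Complex.norm_real, Real.norm_of_nonneg measureReal_nonneg] at h1
    exact_mod_cast h1
  have hcomp := isCompact_setOfPred_finiteMeasure_le_of_compactSpace Torus ‖R 0‖₊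
  obtain ⟨σ, -, hσ⟩ := isCompact_iff_ultrafilter_le_nhds.1 hcomp ((hyperfilter ℕ).map μ)
    (by
      rw [le_principal_iff]
      exact Eventually.of_forall (f := (hyperfilter ℕ : Filter ℕ)) hmass)
  have hσ' : Tendsto μ (hyperfilter ℕ) (𝓝 σ) := hσ
  rw [FiniteMeasure.tendsto_iff_forall_integral_rclike_tendsto ℂ] at hσ'
  refine ⟨σ, inferInstance, fun m => ?_⟩
  have h1 := hσ' (BoundedContinuousFunction.mkOfCompact (fourier m))
  refine tendsto_nhds_unique h1 ?_
  have h2 : ∀ N, ∫ x, BoundedContinuousFunction.mkOfCompact (fourier m) x ∂(μ N : Measure Torus) =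
    ((N : ℂ)⁻¹ * ((N - m.natAbs : ℕ) : ℂ)) * R m := fun N => hν N m
  simp_rw [h2]
  have h3 : Tendsto (fun N : ℕ => 1 - (m.natAbs : ℂ) * (N : ℂ)⁻¹) atTop (𝓝 (1 - m.natAbs * 0)) :=
    tendsto_const_nhds.sub (tendsto_const_nhds.mul tendsto_inv_atTop_nhds_zero_nat)
  rw [mul_zero, sub_zero] at h3
  have h4 := (h3.mul_const (R m)).mono_left Nat.hyperfilter_le_atTop
  rw [one_mul] at h4
  refine h4.congr' ?_
  filter_upwards [Nat.hyperfilter_le_atTop (eventually_gt_atTop m.natAbs)] with N hN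
  have hN0 : (N : ℂ) ≠ 0 := Nat.cast_ne_zero.2 (by omega)
  rw [Nat.cast_sub hN.le]
  field_simp

/-! ### The spectral representation of jointly stationary sequences in a Hilbert space -/

section Density

variable {σ : Measure Torus} [IsFiniteMeasure σ]

variable (σ) in
/-- The trigonometric polynomial with coefficients `c`, as an element of `L²(σ)`. -/
noncomputable def trigLp : (ℤ →₀ ℂ) →ₗ[ℂ] Lp ℂ 2 σ :=
  Finsupp.linearCombination ℂ fun m => periodLp σ (expChar m)

/-- The trigonometric polynomial with coefficients `c`, as a function on the line. -/
noncomputable def trigFun (c : ℤ →₀ ℂ) : ℝ → ℂ := ∑ m ∈ c.support, c m • expChar m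

lemma isBoundedOnPeriod_trigFun (c : ℤ →₀ ℂ) : IsBoundedOnPeriod (trigFun c) :=
  .sum fun m _ => (IsBoundedOnPeriod.expChar m).const_smul _

lemma periodLp_trigFun (c : ℤ →₀ ℂ) : periodLp σ (trigFun c) = trigLp σ c := by
  rw [trigFun, periodLp_sum fun m _ => (IsBoundedOnPeriod.expChar m).const_smul _, trigLp,
    Finsupp.linearCombination_apply, Finsupp.sum]
  exact Finset.sum_congr rfl fun m _ => periodLp_smul _ (.expChar m)

lemma periodLp_expChar (m : ℤ) :
    periodLp σ (expChar m) = ContinuousMap.toLp (E := ℂ) 2 σ ℂ (fourier m) := by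
  refine Lp.ext ?_
  filter_upwards [coeFn_periodLp (σ := σ) (.expChar m),
    ContinuousMap.coeFn_toLp (E := ℂ) (p := 2) (𝕜 := ℂ) σ (fourier m)] with x h₁ h₂
  rw [h₁, h₂, fourier_eq_expChar]

lemma denseRange_trigLp : DenseRange (trigLp σ) := by
  have h := (ContinuousMap.toLp_denseRange ℂ σ ℂ (p := 2)
    (by norm_num)).topologicalClosure_map_submodule
    (span_fourier_closure_eq_top (T := 2 * Real.pi))
  rw [Submodule.map_span, ← Set.range_comp, ← Submodule.dense_iff_topologicalClosure_eq_top,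
    ← Finsupp.range_linearCombination] at h
  simpa [DenseRange, trigLp, periodLp_expChar, Function.comp_def, LinearMap.coe_range] using h

lemma exists_norm_periodLp_sub_trigFun_lt {f : ℝ → ℂ} (hf : IsBoundedOnPeriod f) {ε : ℝ}
    (hε : 0 < ε) : ∃ c, ‖periodLp σ (f - trigFun c)‖ < ε := by
  obtain ⟨c, hc⟩ := (denseRange_trigLp (σ := σ)).exists_dist_lt (periodLp σ f) hε
  refine ⟨c, ?_⟩
  rwa [periodLp_sub hf (isBoundedOnPeriod_trigFun c), periodLp_trigFun, ← dist_eq_norm]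

/-- An additive and homogeneous map on bounded functions that is dominated by the norm of `L²(σ)`
vanishes if it vanishes on characters. The hypothesis `hsmul` covers both linear and
conjugate-linear maps. -/
lemma eq_of_eq_on_expChar {E : Type*} [NormedAddCommGroup E] [NormedSpace ℂ E]
    {D : (ℝ → ℂ) → E} {K : ℝ}
    (hadd : ∀ f g, IsBoundedOnPeriod f → IsBoundedOnPeriod g → D (f + g) = D f + D g)
    (hsmul : ∀ (a : ℂ) f, IsBoundedOnPeriod f → ∃ b : ℂ, D (a • f) = b • D f)
    (hbound : ∀ f, IsBoundedOnPeriod f → ‖D f‖ ≤ K * ‖periodLp σ f‖)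
    (hexp : ∀ m, D (expChar m) = 0) {f : ℝ → ℂ} (hf : IsBoundedOnPeriod f) : D f = 0 := by
  have hsum : ∀ (c : ℤ → ℂ) (S : Finset ℤ), D (∑ m ∈ S, c m • expChar m) = 0 := by
    intro c S
    induction S using Finset.cons_induction with
    | empty =>
      obtain ⟨b, hb⟩ := hsmul 0 (expChar 0) (.expChar 0)
      rw [Finset.sum_empty, ← zero_smul ℂ (expChar 0), hb, hexp, smul_zero]
    | cons m S hm ih =>
      obtain ⟨b, hb⟩ := hsmul (c m) (expChar m) (.expChar m)
      rw [Finset.sum_cons, hadd _ _ ((IsBoundedOnPeriod.expChar m).const_smul _)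
        (.sum fun k _ => (IsBoundedOnPeriod.expChar k).const_smul _), ih, hb, hexp, smul_zero,
        add_zero]
  rw [← norm_le_zero_iff]
  refine le_of_forall_pos_le_add fun ε hε => ?_
  obtain ⟨c, hc⟩ := exists_norm_periodLp_sub_trigFun_lt (σ := σ) hf
    (show 0 < ε / (|K| + 1) by positivity)
  have hfc := hf.sub (isBoundedOnPeriod_trigFun c)
  have h : D f = D (f - trigFun c) := by
    conv_lhs => rw [← sub_add_cancel f (trigFun c)]
    rw [hadd _ _ hfc (isBoundedOnPeriod_trigFun c)]
    rw [show D (trigFun c) = 0 from hsum _ _, add_zero]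
  rw [h, zero_add]
  calc _ ≤ |K| * (ε / (|K| + 1)) := (hbound _ hfc).trans
        ((mul_le_mul_of_nonneg_right (le_abs_self K) (norm_nonneg _)).trans
          (mul_le_mul_of_nonneg_left hc.le (abs_nonneg _)))
    _ = ε * (|K| / (|K| + 1)) := by ring
    _ ≤ ε * 1 := by
        refine mul_le_mul_of_nonneg_left ?_ hε.le
        rw [div_le_one (by positivity)]
        linarith
    _ = ε := mul_one ε

end Density

section Hilbert

variable {E : Type*} [NormedAddCommGroup E] [InnerProductSpace ℂ E] [CompleteSpace E]
  {ι : Type*} [Fintype ι] {η : ι → ℤ → E}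

open scoped InnerProductSpace

lemma inner_periodLp_expChar {σ : Measure Torus} [IsFiniteMeasure σ] (m n : ℤ) :
    ⟪periodLp σ (expChar m), periodLp σ (expChar n)⟫_ℂ = ∫ x, fourier (n - m) x ∂σ := by
  rw [L2.inner_def]
  refine integral_congr_ae ?_
  filter_upwards [coeFn_periodLp (σ := σ) (.expChar m), coeFn_periodLp (σ := σ) (.expChar n)]
    with x h₁ h₂
  rw [h₁, h₂, fourier_eq_expChar, RCLike.inner_apply, conj_expChar, sub_eq_add_neg, expChar_add]

/-- Kolmogorov's isomorphism, for a control measure common to all components: there are a finite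
measure `σ` on the circle and bounded operators from `L²(σ)` that send the characters `e^(imx)` to
the terms of the stationary sequences. The measure `σ` is the trace of the matrix spectral
measure. -/
theorem exists_spectral_operators
    (hη : ∀ p q m n k, ⟪η p (m + k), η q (n + k)⟫_ℂ = ⟪η p m, η q n⟫_ℂ) :
    ∃ σ : Measure Torus, ∃ _ : IsFiniteMeasure σ, ∃ V : ι → Lp ℂ 2 σ →L[ℂ] E,
      ∀ p m, V p (periodLp σ (expChar m)) = η p m := by
  set R : ℤ → ℂ := fun m => ∑ p, ⟪η p 0, η p m⟫_ℂ with hR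
  have hRsub : ∀ k l, R (k - l) = ∑ p, ⟪η p l, η p k⟫_ℂ := fun k l =>
    Finset.sum_congr rfl fun p _ => by simpa using (hη p p 0 (k - l) l).symm
  have hquad : ∀ (S : Finset ℤ) (c : ℤ → ℂ), ∑ k ∈ S, ∑ l ∈ S, c k * conj (c l) * R (k - l) =
      ∑ p, ⟪∑ l ∈ S, c l • η p l, ∑ k ∈ S, c k • η p k⟫_ℂ := by
    intro S c
    simp_rw [hRsub, sum_inner, inner_sum, inner_smul_left, inner_smul_right, Finset.mul_sum]
    rw [Finset.sum_comm]
    simp_rw [Finset.sum_comm (s := S) (t := Finset.univ)]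
    refine Finset.sum_congr rfl fun p _ => Finset.sum_congr rfl fun k _ =>
      Finset.sum_congr rfl fun l _ => ?_
    ring
  obtain ⟨σ, hσ, hσR⟩ := exists_measure_integral_fourier (R := R) fun S c => by
    rw [hquad]
    exact Finset.sum_nonneg fun p _ => by
      rw [inner_self_eq_norm_sq_to_K]
      positivity
  have hnorm : ∀ c : ℤ →₀ ℂ, ‖trigLp σ c‖ ^ 2 =
      ∑ p, ‖Finsupp.linearCombination ℂ (η p) c‖ ^ 2 := by
    intro c
    have h1 : ⟪trigLp σ c, trigLp σ c⟫_ℂ =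
        ∑ k ∈ c.support, ∑ l ∈ c.support, c k * conj (c l) * R (k - l) := by
      simp only [trigLp, Finsupp.linearCombination_apply, Finsupp.sum]
      simp_rw [sum_inner, inner_sum, inner_smul_left, inner_smul_right, inner_periodLp_expChar,
        hσR]
      rw [Finset.sum_comm]
      refine Finset.sum_congr rfl fun k _ => Finset.sum_congr rfl fun l _ => ?_
      ring
    rw [hquad, inner_self_eq_norm_sq_to_K] at h1
    simp_rw [inner_self_eq_norm_sq_to_K] at h1
    simp only [Finsupp.linearCombination_apply, Finsupp.sum]
    exact_mod_cast h1
  have hle : ∀ p, ∃ C, ∀ c : ℤ →₀ ℂ,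
      ‖Finsupp.linearCombination ℂ (η p) c‖ ≤ C * ‖trigLp σ c‖ := by
    refine fun p => ⟨1, fun c => ?_⟩
    rw [one_mul]
    refine le_of_sq_le_sq ?_ (norm_nonneg _)
    rw [hnorm]
    exact Finset.single_le_sum (f := fun p => ‖Finsupp.linearCombination ℂ (η p) c‖ ^ 2)
      (fun _ _ => sq_nonneg _) (Finset.mem_univ p)
  refine ⟨σ, hσ, fun p => (Finsupp.linearCombination ℂ (η p)).extendOfNorm (trigLp σ),
    fun p m => ?_⟩
  have h := LinearMap.extendOfNorm_eq denseRange_trigLp (hle p) (Finsupp.single m 1)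
  simpa [trigLp] using h

variable {σ : Measure Torus} [IsFiniteMeasure σ] {V : ι → Lp ℂ 2 σ →L[ℂ] E}

/-- The functional on `L²(σ)` given by the density, with respect to `σ`, of the `(p, q)` entry of
the matrix spectral measure. -/
noncomputable def crossFunctional (V : ι → Lp ℂ 2 σ →L[ℂ] E) (p q : ι) : Lp ℂ 2 σ →L[ℂ] ℂ :=
  (innerSL ℂ (V q (periodLp σ (expChar 0)))).comp (V p)

omit [CompleteSpace E] [Fintype ι] [IsFiniteMeasure σ] in
lemma crossFunctional_apply (p q : ι) (f : Lp ℂ 2 σ) :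
    crossFunctional V p q f = ⟪V q (periodLp σ (expChar 0)), V p f⟫_ℂ := rfl

omit [CompleteSpace E] [Fintype ι] in
/-- Inner products of spectral integrals depend on the integrands only through `f * conj g`: the
operators `V q* ∘ V p` commute with multiplications. -/
theorem inner_eq_crossFunctional
    (hη : ∀ p q m n k, ⟪η p (m + k), η q (n + k)⟫_ℂ = ⟪η p m, η q n⟫_ℂ)
    (hV : ∀ p m, V p (periodLp σ (expChar m)) = η p m) (p q : ι) {f g : ℝ → ℂ}
    (hf : IsBoundedOnPeriod f) (hg : IsBoundedOnPeriod g) :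
    ⟪V q (periodLp σ g), V p (periodLp σ f)⟫_ℂ =
      crossFunctional V p q (periodLp σ (f * fun x => conj (g x))) := by
  have bound : ∀ u v : Lp ℂ 2 σ, ‖⟪V q u, V p v⟫_ℂ‖ ≤ ‖V q‖ * ‖V p‖ * ‖u‖ * ‖v‖ := fun u v =>
    (norm_inner_le_norm _ _).trans <| (mul_le_mul ((V q).le_opNorm u) ((V p).le_opNorm v)
      (norm_nonneg _) (by positivity)).trans_eq (by ring)
  -- the case where `g` is a character
  have h1 : ∀ (n : ℤ) (f : ℝ → ℂ), IsBoundedOnPeriod f →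
      ⟪V q (periodLp σ (expChar n)), V p (periodLp σ f)⟫_ℂ -
        crossFunctional V p q (periodLp σ (f * expChar (-n))) = 0 := by
    intro n f hf
    refine eq_of_eq_on_expChar (σ := σ)
      (D := fun f => ⟪V q (periodLp σ (expChar n)), V p (periodLp σ f)⟫_ℂ -
        crossFunctional V p q (periodLp σ (f * expChar (-n))))
      (K := ‖V q‖ * ‖V p‖ * ‖periodLp σ (expChar n)‖ + ‖crossFunctional V p q‖)
      (fun f g hf hg => ?_) (fun a f hf => ⟨a, ?_⟩) (fun f hf => ?_) (fun m => ?_) hf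
    · rw [add_mul, periodLp_add hf hg, periodLp_add (hf.mul (.expChar _)) (hg.mul (.expChar _))]
      simp only [map_add, inner_add_right]
      ring
    · rw [smul_mul_assoc, periodLp_smul a hf, periodLp_smul a (hf.mul (.expChar _))]
      simp only [map_smul, inner_smul_right, smul_eq_mul]
      ring
    · rw [add_mul]
      refine norm_sub_le_of_le (bound _ _) (((crossFunctional V p q).le_opNorm _).trans
        (mul_le_mul_of_nonneg_left ?_ (norm_nonneg _)))
      rw [mul_comm f]
      simpa using norm_periodLp_mul_le (σ := σ) (C := 1) (.expChar (-n)) hf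
        fun x _ => (norm_expChar (-n) x).le
    · rw [show expChar m * expChar (-n) = expChar (m - n) by
        ext x; rw [sub_eq_add_neg, expChar_add]; rfl, crossFunctional_apply, hV, hV, hV, hV,
        sub_eq_zero]
      simpa using hη q p 0 (m - n) n
  obtain ⟨C, hC0, hC⟩ := hf.bounded
  rw [← sub_eq_zero]
  refine eq_of_eq_on_expChar (σ := σ)
    (D := fun g => ⟪V q (periodLp σ g), V p (periodLp σ f)⟫_ℂ -
      crossFunctional V p q (periodLp σ (f * fun x => conj (g x))))
    (K := ‖V q‖ * ‖V p‖ * ‖periodLp σ f‖ + ‖crossFunctional V p q‖ * C)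
    (fun g g' hg hg' => ?_) (fun a g hg => ⟨conj a, ?_⟩) (fun g hg => ?_) (fun m => ?_) hg
  · rw [show (f * fun x => conj ((g + g') x)) = (f * fun x => conj (g x)) +
      f * fun x => conj (g' x) by ext x; simp [mul_add], periodLp_add hg hg',
      periodLp_add (hf.mul hg.star) (hf.mul hg'.star)]
    simp only [map_add, inner_add_left]
    ring
  · rw [show (f * fun x => conj ((a • g) x)) = conj a • (f * fun x => conj (g x)) by
      ext x; simp; ring, periodLp_smul a hg, periodLp_smul _ (hf.mul hg.star)]
    simp only [map_smul, inner_smul_left, smul_eq_mul]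
    ring
  · rw [add_mul]
    refine norm_sub_le_of_le ((bound _ _).trans_eq (by ring))
      (((crossFunctional V p q).le_opNorm _).trans ?_)
    rw [mul_assoc]
    refine mul_le_mul_of_nonneg_left ?_ (norm_nonneg _)
    rw [← norm_periodLp_conj hg]
    exact norm_periodLp_mul_le hf hg.star hC
  · simp only [conj_expChar]
    exact h1 m f hf

/-- A functional that is constant on the characters is carried by the frequency `0`. -/
theorem eq_zero_of_const_on_expChar {L : Lp ℂ 2 σ →L[ℂ] ℂ}
    (hL : ∀ m, L (periodLp σ (expChar m)) = L (periodLp σ (expChar 0))) {f : ℝ → ℂ}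
    (hf : IsBoundedOnPeriod f) (h0 : f 0 = 0) : L (periodLp σ f) = 0 := by
  -- `L` is invariant under multiplication by `e^(ix)`
  have hinv : ∀ f, IsBoundedOnPeriod f → L (periodLp σ (expChar 1 * f)) - L (periodLp σ f) = 0 := by
    intro f hf
    refine eq_of_eq_on_expChar (σ := σ)
      (D := fun f => L (periodLp σ (expChar 1 * f)) - L (periodLp σ f)) (K := ‖L‖ + ‖L‖)
      (fun f g hf hg => ?_) (fun a f hf => ⟨a, ?_⟩) (fun f hf => ?_) (fun m => ?_) hf
    · rw [mul_add, periodLp_add hf hg, periodLp_add (.mul (.expChar _) hf) (.mul (.expChar _) hg)]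
      simp only [map_add]
      ring
    · rw [mul_smul_comm, periodLp_smul a hf, periodLp_smul a (.mul (.expChar _) hf)]
      simp only [map_smul, smul_eq_mul]
      ring
    · rw [add_mul]
      refine norm_sub_le_of_le ((L.le_opNorm _).trans (mul_le_mul_of_nonneg_left ?_
        (norm_nonneg _))) (L.le_opNorm _)
      simpa using norm_periodLp_mul_le (σ := σ) (C := 1) (.expChar 1) hf
        fun x _ => (norm_expChar 1 x).le
    · rw [show expChar 1 * expChar m = expChar (1 + m) by ext x; rw [expChar_add]; rfl, hL, hL m,
        sub_self]
  -- approximate `f` by `(e^(ix) - 1) * (ψ n * f)`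
  set z : ℝ → ℂ := fun x => expChar 1 x - 1 with hz
  have hzc : Continuous z := (continuous_expChar 1).sub continuous_const
  set ψ : ℕ → ℝ → ℂ := fun n x => conj (z x) / ((‖z x‖ ^ 2 + 1 / ((n : ℝ) + 1) : ℝ) : ℂ) with hψ
  have hden : ∀ (n : ℕ) x, 0 < ‖z x‖ ^ 2 + 1 / ((n : ℝ) + 1) := fun n x => by positivity
  have hψc : ∀ n, Continuous (ψ n) := fun n => by
    refine (Complex.continuous_conj.comp hzc).div (Complex.continuous_ofReal.comp
      ((hzc.norm.pow 2).add continuous_const)) fun x => ?_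
    exact Complex.ofReal_ne_zero.2 (hden n x).ne'
  have hψf : ∀ n, IsBoundedOnPeriod (ψ n * f) := fun n =>
    (IsBoundedOnPeriod.of_continuous (hψc n)).mul hf
  have hval : ∀ n x, z x * ψ n x =
      ((‖z x‖ ^ 2 / (‖z x‖ ^ 2 + 1 / ((n : ℝ) + 1)) : ℝ) : ℂ) := by
    intro n x
    rw [hψ]
    simp only
    rw [mul_div_assoc', Complex.mul_conj', Complex.ofReal_div, Complex.ofReal_pow]
  have hzero : ∀ n, L (periodLp σ (z * (ψ n * f))) = 0 := by
    intro n
    have h := hinv _ (hψf n)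
    rw [← map_sub, ← periodLp_sub (.mul (.expChar _) (hψf n)) (hψf n)] at h
    rwa [show z * (ψ n * f) = expChar 1 * (ψ n * f) - ψ n * f by
      ext x; simp only [hz, Pi.mul_apply, Pi.sub_apply]; ring]
  obtain ⟨C, hC0, hC⟩ := hf.bounded
  have hlim : Tendsto (fun n => periodLp σ (z * (ψ n * f))) atTop (𝓝 (periodLp σ f)) := by
    refine tendsto_periodLp (C := C) (fun n => (IsBoundedOnPeriod.of_continuous hzc).mul (hψf n)) hf
      (fun n x hx => ?_) (fun x hx => ?_)
    · rw [Pi.mul_apply, Pi.mul_apply, ← mul_assoc, hval, norm_mul, Complex.norm_real,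
        Real.norm_of_nonneg (div_nonneg (sq_nonneg _) (hden n x).le)]
      refine (mul_le_of_le_one_left (norm_nonneg _) ?_).trans (hC x hx)
      rw [div_le_one (hden n x)]
      have : 0 < 1 / ((n : ℝ) + 1) := by positivity
      linarith
    · simp only [Pi.mul_apply, ← mul_assoc, hval]
      rcases eq_or_ne x 0 with rfl | hx0
      · simp [h0]
      · have hzx : z x ≠ 0 := by
          intro hzx
          rw [hz] at hzx
          simp only [expChar, sub_eq_zero] at hzx
          rw [Complex.exp_eq_one_iff] at hzx
          obtain ⟨k, hk⟩ := hzx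
          have hk' : (x : ℂ) = k * (2 * Real.pi) := by
            refine mul_left_cancel₀ Complex.I_ne_zero ?_
            push_cast at hk
            linear_combination hk
          have hk'' : x = k * (2 * Real.pi) := by exact_mod_cast hk'
          have hk0 : k = 0 := by
            have h1 : (k : ℝ) < 1 := by
              by_contra! h
              nlinarith [hx.2, Real.pi_pos]
            have h2 : (-1 : ℝ) < k := by
              by_contra! h
              nlinarith [hx.1, Real.pi_pos]
            have h1' : k < 1 := by exact_mod_cast h1
            have h2' : -1 < k := by exact_mod_cast h2
            omega
          exact hx0 (by rw [hk'', hk0]; simp)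
        have h1 : Tendsto (fun n : ℕ => ‖z x‖ ^ 2 / (‖z x‖ ^ 2 + 1 / ((n : ℝ) + 1))) atTop
            (𝓝 (‖z x‖ ^ 2 / (‖z x‖ ^ 2 + 0))) :=
          tendsto_const_nhds.div (tendsto_const_nhds.add tendsto_one_div_add_atTop_nhds_zero_nat)
            (by simpa using hzx)
        rw [add_zero, div_self (by simpa using hzx)] at h1
        simpa using ((Complex.continuous_ofReal.tendsto _).comp h1).mul_const (f x)
  refine tendsto_nhds_unique ((L.continuous.tendsto _).comp hlim) ?_
  simp only [Function.comp_def, hzero]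
  exact tendsto_const_nhds

end Hilbert

/-! ### Uniqueness of the spectral function -/

section RiemannStieltjes

variable {E : Type*} [NormedAddCommGroup E] [NormedSpace ℂ E] {f : ℝ → ℂ} {G G' : ℝ → E}
  {a b : ℝ} {I I' : E}

lemma HasRSIntegral.add (h : HasRSIntegral f G a b I) (h' : HasRSIntegral f G' a b I') :
    HasRSIntegral f (fun x => G x + G' x) a b (I + I') := by
  intro ε hε
  obtain ⟨δ, hδ, H⟩ := h (ε / 2) (half_pos hε)
  obtain ⟨δ', hδ', H'⟩ := h' (ε / 2) (half_pos hε)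
  refine ⟨min δ δ', lt_min hδ hδ', fun n t τ h0 hn ht => ?_⟩
  have h1 := H n t τ h0 hn fun i hi => ⟨(ht i hi).1, (ht i hi).2.1,
    (ht i hi).2.2.trans_le (min_le_left _ _)⟩
  have h2 := H' n t τ h0 hn fun i hi => ⟨(ht i hi).1, (ht i hi).2.1,
    (ht i hi).2.2.trans_le (min_le_right _ _)⟩
  have h3 : ∑ i ∈ Finset.range n, f (τ i) • (G (t (i + 1)) + G' (t (i + 1)) - (G (t i) + G' (t i)))
      - (I + I') = (∑ i ∈ Finset.range n, f (τ i) • (G (t (i + 1)) - G (t i)) - I) +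
        (∑ i ∈ Finset.range n, f (τ i) • (G' (t (i + 1)) - G' (t i)) - I') := by
    rw [sub_add_sub_comm, ← Finset.sum_add_distrib]
    simp_rw [← smul_add, add_sub_add_comm]
  rw [h3]
  exact (norm_add_le _ _).trans_lt (by linarith)

lemma HasRSIntegral.const_smul (c : ℂ) (h : HasRSIntegral f G a b I) :
    HasRSIntegral f (fun x => c • G x) a b (c • I) := by
  intro ε hε
  obtain ⟨δ, hδ, H⟩ := h (ε / (‖c‖ + 1)) (by positivity)
  refine ⟨δ, hδ, fun n t τ h0 hn ht => ?_⟩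
  have h1 : ∑ i ∈ Finset.range n, f (τ i) • (c • G (t (i + 1)) - c • G (t i)) - c • I =
      c • (∑ i ∈ Finset.range n, f (τ i) • (G (t (i + 1)) - G (t i)) - I) := by
    rw [smul_sub, Finset.smul_sum]
    simp_rw [← smul_sub, smul_comm c]
  rw [h1, norm_smul]
  have h2 := H n t τ h0 hn ht
  rw [lt_div_iff₀ (by positivity)] at h2
  nlinarith [norm_nonneg c, norm_nonneg
    (∑ i ∈ Finset.range n, f (τ i) • (G (t (i + 1)) - G (t i)) - I)]

lemma HasRSIntegral.sum {ι : Type*} {S : Finset ι} {G : ι → ℝ → E} {I : ι → E}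
    (h : ∀ i ∈ S, HasRSIntegral f (G i) a b (I i)) :
    HasRSIntegral f (fun x => ∑ i ∈ S, G i x) a b (∑ i ∈ S, I i) := by
  induction S using Finset.cons_induction with
  | empty => exact fun ε hε => ⟨1, one_pos, fun n t τ _ _ _ => by simpa using hε⟩
  | cons i S hi ih =>
    simp only [Finset.sum_cons]
    exact (h i (Finset.mem_cons_self i S)).add
      (ih fun j hj => h j (Finset.mem_cons_of_mem hj))

lemma HasRSIntegral.unique (hab : a < b) (h : HasRSIntegral f G a b I)
    (h' : HasRSIntegral f G a b I') : I = I' := by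
  rw [← sub_eq_zero, ← norm_le_zero_iff]
  refine le_of_forall_pos_le_add fun ε hε => ?_
  obtain ⟨δ, hδ, H⟩ := h (ε / 2) (half_pos hε)
  obtain ⟨δ', hδ', H'⟩ := h' (ε / 2) (half_pos hε)
  obtain ⟨n, hn⟩ := exists_nat_gt ((b - a) / min δ δ')
  have hm : 0 < min δ δ' := lt_min hδ hδ'
  have hn0 : (0 : ℝ) < n := (div_pos (sub_pos.2 hab) hm).trans hn
  have hstep : (b - a) / n < min δ δ' := by
    rw [div_lt_iff₀ hm] at hn
    rw [div_lt_iff₀ hn0]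
    linarith
  have hpos : 0 < (b - a) / n := div_pos (sub_pos.2 hab) hn0
  set t : ℕ → ℝ := fun i => a + i * ((b - a) / n) with ht
  have hsucc : ∀ i, t (i + 1) = t i + (b - a) / n := fun i => by simp only [ht]; push_cast; ring
  have h0 : t 0 = a := by simp [ht]
  have hn' : t n = b := by simp only [ht]; field_simp; ring
  have h1 := H n t t h0 hn' fun i _ => ⟨le_rfl, by rw [hsucc]; linarith, by
    rw [hsucc, add_sub_cancel_left]; exact hstep.trans_le (min_le_left _ _)⟩
  have h2 := H' n t t h0 hn' fun i _ => ⟨le_rfl, by rw [hsucc]; linarith, by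
    rw [hsucc, add_sub_cancel_left]; exact hstep.trans_le (min_le_right _ _)⟩
  rw [norm_sub_rev] at h1
  rw [zero_add, ← sub_add_sub_cancel I
    (∑ i ∈ Finset.range n, f (t i) • (G (t (i + 1)) - G (t i))) I']
  exact (norm_add_le _ _).trans (by linarith)

end RiemannStieltjes

/-- A left-continuous nondecreasing function on `[-π, π]` is the distribution function of a finite
measure on the circle. -/
lemma exists_measure_of_monotone {g : ℝ → ℂ}
    (hmono : ∀ a b, -Real.pi ≤ a → a ≤ b → b ≤ Real.pi → 0 ≤ g b - g a)
    (hcont : ∀ x, -Real.pi < x → x ≤ Real.pi → ContinuousWithinAt g (Set.Iio x) x) :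
    ∃ ν : Measure Torus, IsFiniteMeasure ν ∧ ∀ a b, -Real.pi ≤ a → a ≤ b → b ≤ Real.pi →
      g b - g a = (ν.real (torusArg ⁻¹' Set.Ico a b) : ℂ) := by
  have hpi := Real.pi_pos
  -- the function is continued by constants outside `[-π, π]`
  set u : ℝ → ℝ := fun x => max (-Real.pi) (min x Real.pi) with hu
  have hu_mem : ∀ x, -Real.pi ≤ u x ∧ u x ≤ Real.pi := fun x =>
    ⟨le_max_left _ _, max_le (by linarith) (min_le_right _ _)⟩
  have hu_mono : Monotone u := fun x y hxy => max_le_max le_rfl (min_le_min hxy le_rfl)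
  have hu_eq : ∀ x, -Real.pi ≤ x → x ≤ Real.pi → u x = x := fun x h1 h2 => by
    simp only [hu]; rw [min_eq_left h2, max_eq_right h1]
  set k : ℝ → ℝ := fun x => (g (u x)).re with hk
  have hk_mono : Monotone k := fun x y hxy => by
    have h := (Complex.le_def.1 (hmono _ _ (hu_mem x).1 (hu_mono hxy) (hu_mem y).2)).1
    simpa using h
  have hk_left : ∀ x, -Real.pi ≤ x → x ≤ Real.pi → Function.leftLim k x = k x := by
    intro x hx1 hx2
    refine ContinuousWithinAt.leftLim_eq ?_
    rcases hx1.eq_or_lt with rfl | hx1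
    · refine (continuousWithinAt_const (b := k (-Real.pi))).congr (fun y hy => ?_) rfl
      have hy' : y ≤ -Real.pi := hy
      simp only [hk, hu]
      rw [min_eq_left (by linarith), max_eq_left hy',
        min_eq_left (by linarith), max_self]
    · have hc : ContinuousWithinAt (fun y => (g y).re) (Set.Iic x) x :=
        continuousWithinAt_Iio_iff_Iic.1
          (Complex.continuous_re.continuousAt.comp_continuousWithinAt (hcont x hx1 hx2))
      refine hc.congr_of_eventuallyEq ?_ (by simp only [hk]; rw [hu_eq x hx1.le hx2])
      filter_upwards [Ioc_mem_nhdsLE hx1] with y hy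
      simp only [hk]
      rw [hu_eq y hy.1.le (hy.2.trans hx2)]
  have hlim : ∀ x, -Real.pi ≤ x → x ≤ Real.pi →
      Function.leftLim hk_mono.stieltjesFunction x = k x := by
    intro x hx1 hx2
    rw [← hk_left x hx1 hx2]
    exact leftLim_rightLim (hk_mono.tendsto_leftLim x)
  set μ := hk_mono.stieltjesFunction.measure with hμ
  have hIco : ∀ a b, -Real.pi ≤ a → a ≤ b → b ≤ Real.pi →
      μ (Set.Ico a b) = ENNReal.ofReal (k b - k a) := fun a b ha hab hb => by
    rw [hμ, StieltjesFunction.measure_Ico, hlim b (ha.trans hab) hb, hlim a ha (hab.trans hb)]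
  have hfin : IsFiniteMeasure (μ.restrict (Set.Ico (-Real.pi) Real.pi)) := ⟨by
    rw [Measure.restrict_apply_univ, hIco _ _ le_rfl (by linarith) le_rfl]
    exact ENNReal.ofReal_lt_top⟩
  have hmeas : Measurable ((↑) : ℝ → Torus) := AddCircle.measurable_mk'
  refine ⟨(μ.restrict (Set.Ico (-Real.pi) Real.pi)).map (↑), inferInstance,
    fun a b ha hab hb => ?_⟩
  have hpre : ((↑) : ℝ → Torus) ⁻¹' (torusArg ⁻¹' Set.Ico a b) ∩ Set.Ico (-Real.pi) Real.pi =
      Set.Ico a b := by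
    ext x
    constructor
    · rintro ⟨h1, h2⟩
      have h1' : torusArg (x : Torus) ∈ Set.Ico a b := h1
      rwa [torusArg_coe h2] at h1'
    · intro hx
      have h2 : x ∈ Set.Ico (-Real.pi) Real.pi := ⟨ha.trans hx.1, hx.2.trans_le hb⟩
      refine ⟨?_, h2⟩
      change torusArg (x : Torus) ∈ Set.Ico a b
      rwa [torusArg_coe h2]
  have hS := measurable_torusArg (measurableSet_Ico (a := a) (b := b))
  have hg := hmono a b ha hab hb
  rw [measureReal_def, Measure.map_apply hmeas hS, Measure.restrict_apply (hmeas hS), hpre,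
    hIco a b ha hab hb, ENNReal.toReal_ofReal (sub_nonneg.2 (hk_mono hab))]
  simp only [hk, hu_eq a ha (hab.trans hb), hu_eq b (ha.trans hab) hb]
  rw [← Complex.sub_re]
  exact Complex.eq_re_of_ofReal_le (r := 0) (by simpa using hg)

lemma inner_periodLp_one {ν : Measure Torus} [IsFiniteMeasure ν] {f : ℝ → ℂ}
    (hf : IsBoundedOnPeriod f) :
    innerSL ℂ (periodLp ν (expChar 0)) (periodLp ν f) = ∫ x, f (torusArg x) ∂ν := by
  rw [innerSL_apply_apply, L2.inner_def]
  refine integral_congr_ae ?_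
  filter_upwards [coeFn_periodLp (σ := ν) (.expChar 0), coeFn_periodLp (σ := ν) hf] with x h₁ h₂
  rw [h₁, h₂, RCLike.inner_apply]
  simp [expChar]

/-- The Riemann–Stieltjes integral with respect to the distribution function of a measure. -/
lemma hasRSIntegral_of_measure {ν : Measure Torus} [IsFiniteMeasure ν] {f g : ℝ → ℂ}
    (hf : Continuous f) (hν : ∀ a b, -Real.pi ≤ a → a ≤ b → b ≤ Real.pi →
      g b - g a = (ν.real (torusArg ⁻¹' Set.Ico a b) : ℂ)) :
    HasRSIntegral f g (-Real.pi) Real.pi (∫ x, f (torusArg x) ∂ν) := by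
  have hone : (f * expChar 0) = f := by ext x; simp [expChar]
  have h := hasRSIntegral_of_increments (innerSL ℂ (periodLp ν (expChar 0))) (G := g)
    (.expChar 0) hf fun a b ha hab hb => ?_
  · rwa [hone, inner_periodLp_one (.of_continuous hf)] at h
  rw [inner_periodLp_one ((IsBoundedOnPeriod.expChar 0).indicator measurableSet_Ico),
    hν a b ha hab hb]
  have h1 : ∀ x, (Set.Ico a b).indicator (expChar 0) (torusArg x) =
      (torusArg ⁻¹' Set.Ico a b).indicator (fun _ => (1 : ℂ)) x := fun x => by
    by_cases hx : torusArg x ∈ Set.Ico a b <;> simp [Set.indicator, hx, expChar]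
  simp_rw [h1]
  rw [integral_indicator_const _ (measurable_torusArg measurableSet_Ico)]
  simp

/-- By the Cauchy–Schwarz inequality, integrals with respect to a measure dominated by `σ` are
bounded by the norm of `L²(σ)`. -/
lemma norm_integral_le_periodLp {ν σ : Measure Torus} [IsFiniteMeasure σ] (hle : ν ≤ σ)
    {f : ℝ → ℂ} (hf : IsBoundedOnPeriod f) :
    ‖∫ x, f (torusArg x) ∂ν‖ ≤ ‖periodLp σ (expChar 0)‖ * ‖periodLp σ f‖ := by
  have hfn : IsBoundedOnPeriod fun x => (‖f x‖ : ℂ) := by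
    obtain ⟨C, hC0, hC⟩ := hf.bounded
    exact ⟨Complex.measurable_ofReal.comp hf.measurable.norm, C, hC0, fun x hx => by
      simpa using hC x hx⟩
  have hnorm : ‖periodLp σ fun x => (‖f x‖ : ℂ)‖ ≤ ‖periodLp σ f‖ := by
    refine Lp.norm_le_norm_of_ae_le ?_
    filter_upwards [coeFn_periodLp (σ := σ) hf, coeFn_periodLp (σ := σ) hfn] with x h₁ h₂
    rw [h₁, h₂]
    simp
  have hint : Integrable (fun x => ‖f (torusArg x)‖) σ :=
    ((hf.memLp σ).integrable (by norm_num)).norm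
  calc ‖∫ x, f (torusArg x) ∂ν‖ ≤ ∫ x, ‖f (torusArg x)‖ ∂ν := norm_integral_le_integral_norm _
    _ ≤ ∫ x, ‖f (torusArg x)‖ ∂σ :=
        integral_mono_measure hle (Eventually.of_forall fun _ => norm_nonneg _) hint
    _ ≤ ‖((∫ x, ‖f (torusArg x)‖ ∂σ : ℝ) : ℂ)‖ := by
        rw [Complex.norm_real]; exact Real.le_norm_self _
    _ = ‖innerSL ℂ (periodLp σ (expChar 0)) (periodLp σ fun x => (‖f x‖ : ℂ))‖ := by
        rw [inner_periodLp_one hfn, integral_complex_ofReal]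
    _ ≤ ‖periodLp σ (expChar 0)‖ * ‖periodLp σ f‖ :=
        (norm_inner_le_norm _ _).trans (mul_le_mul_of_nonneg_left hnorm (norm_nonneg _))

/-- A distribution function is determined, up to a constant, by the Fourier coefficients of its
product with a nowhere vanishing continuous density. -/
lemma increment_eq_of_hasRSIntegral {g g' K : ℝ → ℂ} {I : ℤ → ℂ}
    (hmono : ∀ a b, -Real.pi ≤ a → a ≤ b → b ≤ Real.pi → 0 ≤ g b - g a)
    (hcont : ∀ x, -Real.pi < x → x ≤ Real.pi → ContinuousWithinAt g (Set.Iio x) x)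
    (hmono' : ∀ a b, -Real.pi ≤ a → a ≤ b → b ≤ Real.pi → 0 ≤ g' b - g' a)
    (hcont' : ∀ x, -Real.pi < x → x ≤ Real.pi → ContinuousWithinAt g' (Set.Iio x) x)
    (hK : Continuous K) (hK0 : ∀ x ∈ Set.Icc (-Real.pi) Real.pi, K x ≠ 0)
    (hI : ∀ m, HasRSIntegral (expChar m * K) g (-Real.pi) Real.pi (I m))
    (hI' : ∀ m, HasRSIntegral (expChar m * K) g' (-Real.pi) Real.pi (I m))
    {a b : ℝ} (ha : -Real.pi ≤ a) (hab : a ≤ b) (hb : b ≤ Real.pi) : g b - g a = g' b - g' a := by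
  have hpi : -Real.pi < Real.pi := by linarith [Real.pi_pos]
  obtain ⟨ν, hν, hg⟩ := exists_measure_of_monotone hmono hcont
  obtain ⟨ν', hν', hg'⟩ := exists_measure_of_monotone hmono' hcont'
  have hKb := IsBoundedOnPeriod.of_continuous hK
  obtain ⟨C, hC0, hC⟩ := hKb.bounded
  have hint : ∀ {f : ℝ → ℂ}, IsBoundedOnPeriod f → ∀ (ρ : Measure Torus) [IsFiniteMeasure ρ],
      Integrable (fun x => f (torusArg x)) ρ := fun hf ρ _ => (hf.memLp ρ).integrable (by norm_num)
  set D : (ℝ → ℂ) → ℂ := fun f =>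
    ∫ x, (K * f) (torusArg x) ∂ν - ∫ x, (K * f) (torusArg x) ∂ν' with hD
  have hzero : ∀ f, IsBoundedOnPeriod f → D f = 0 := by
    intro f hf
    refine eq_of_eq_on_expChar (σ := ν + ν') (D := D)
      (K := 2 * (‖periodLp (ν + ν') (expChar 0)‖ * C)) (fun f₁ f₂ h₁ h₂ => ?_)
      (fun c f hf => ⟨c, ?_⟩) (fun f hf => ?_) (fun m => ?_) hf
    · simp only [hD, mul_add, Pi.add_apply]
      rw [integral_add (hint (hKb.mul h₁) ν) (hint (hKb.mul h₂) ν),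
        integral_add (hint (hKb.mul h₁) ν') (hint (hKb.mul h₂) ν')]
      ring
    · simp only [hD, mul_smul_comm, Pi.smul_apply, integral_smul, smul_sub]
    · have h1 := norm_integral_le_periodLp (ν := ν) (σ := ν + ν') (Measure.le_add_right le_rfl)
        (hKb.mul hf)
      have h2 := norm_integral_le_periodLp (ν := ν') (σ := ν + ν') (Measure.le_add_left le_rfl)
        (hKb.mul hf)
      have h3 := mul_le_mul_of_nonneg_left (norm_periodLp_mul_le (σ := ν + ν') hKb hf hC)
        (norm_nonneg (periodLp (ν + ν') (expChar 0)))
      exact (norm_sub_le_of_le h1 h2).trans (by linarith)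
    · have hc : Continuous (expChar m * K) := (continuous_expChar m).mul hK
      simp only [hD]
      rw [mul_comm K, ← (hI m).unique hpi (hasRSIntegral_of_measure hc hg),
        ← (hI' m).unique hpi (hasRSIntegral_of_measure hc hg'), sub_self]
  have hinv : IsBoundedOnPeriod fun x => (K x)⁻¹ :=
    .of_continuousOn hK.measurable.inv (hK.continuousOn.inv₀ hK0)
  have h := hzero _ (hinv.indicator (measurableSet_Ico (a := a) (b := b)))
  have h1 : ∀ x, (K * (Set.Ico a b).indicator fun x => (K x)⁻¹) (torusArg x) =
      (torusArg ⁻¹' Set.Ico a b).indicator (fun _ => (1 : ℂ)) x := fun x => by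
    have hx0 := hK0 _ (torusArg_mem_Icc x)
    by_cases hx : torusArg x ∈ Set.Ico a b <;> simp [Set.indicator, hx, hx0]
  simp only [hD, h1] at h
  rw [integral_indicator_const _ (measurable_torusArg measurableSet_Ico),
    integral_indicator_const _ (measurable_torusArg measurableSet_Ico), sub_eq_zero] at h
  rw [hg a b ha hab hb, hg' a b ha hab hb]
  simpa using h

lemma eq_of_star_dotProduct_mulVec_eq {T : ℕ} {A B : Matrix (Fin T) (Fin T) ℂ}
    (h : ∀ v : Fin T → ℂ, star v ⬝ᵥ A.mulVec v = star v ⬝ᵥ B.mulVec v) : A = B := by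
  rw [← sub_eq_zero]
  refine Matrix.toEuclideanLin.injective ?_
  rw [map_zero, ← inner_map_self_eq_zero]
  intro x
  rw [← inner_conj_symm, EuclideanSpace.inner_eq_star_dotProduct, map_eq_zero, dotProduct_comm,
    Matrix.ofLp_toLpLin, Matrix.toLin'_apply, Matrix.sub_mulVec, dotProduct_sub, h, sub_self]

/-- The Hermitian form of a matrix-valued distribution function at a fixed vector is a scalar
distribution function, and a Hermitian form determines its matrix. -/
theorem IsMatrixDistribution.sub_eq_sub {T : ℕ} {F G : ℝ → Matrix (Fin T) (Fin T) ℂ}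
    (hF : IsMatrixDistribution F) (hG : IsMatrixDistribution G) {K : ℝ → ℂ}
    {D : ℤ → Matrix (Fin T) (Fin T) ℂ} (hK : Continuous K)
    (hK0 : ∀ x ∈ Set.Icc (-Real.pi) Real.pi, K x ≠ 0)
    (hFD : ∀ m p q, HasRSIntegral (expChar m * K) (fun x => F x p q) (-Real.pi) Real.pi (D m p q))
    (hGD : ∀ m p q, HasRSIntegral (expChar m * K) (fun x => G x p q) (-Real.pi) Real.pi (D m p q))
    {x : ℝ} (hx : x ∈ Set.Icc (-Real.pi) Real.pi) :
    G x - G (-Real.pi) = F x - F (-Real.pi) := by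
  have hmono : ∀ {H : ℝ → Matrix (Fin T) (Fin T) ℂ}, IsMatrixDistribution H → ∀ (v : Fin T → ℂ) a b,
      -Real.pi ≤ a → a ≤ b → b ≤ Real.pi →
      0 ≤ star v ⬝ᵥ (H b).mulVec v - star v ⬝ᵥ (H a).mulVec v := fun hH v a b ha hab hb => by
    rw [← dotProduct_sub, ← Matrix.sub_mulVec]
    exact (hH.mono a b ha hab hb).dotProduct_mulVec_nonneg v
  have hcont : ∀ {H : ℝ → Matrix (Fin T) (Fin T) ℂ}, IsMatrixDistribution H → ∀ (v : Fin T → ℂ) x,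
      -Real.pi < x → x ≤ Real.pi →
      ContinuousWithinAt (fun y => star v ⬝ᵥ (H y).mulVec v) (Set.Iio x) x := fun hH v x h1 h2 => by
    have hc : Continuous fun M : Matrix (Fin T) (Fin T) ℂ => star v ⬝ᵥ M.mulVec v := by fun_prop
    exact hc.continuousAt.comp_continuousWithinAt (hH.left_cont x h1 h2)
  have hform : ∀ (M : Matrix (Fin T) (Fin T) ℂ) (v : Fin T → ℂ), star v ⬝ᵥ M.mulVec v =
      ∑ p, ∑ q, (conj (v p) * v q) • M p q := fun M v => by
    simp only [dotProduct, Matrix.mulVec, Finset.mul_sum, Pi.star_apply, smul_eq_mul]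
    refine Finset.sum_congr rfl fun p _ => Finset.sum_congr rfl fun q _ => ?_
    rw [← starRingEnd_apply]
    ring
  have hRS : ∀ {H : ℝ → Matrix (Fin T) (Fin T) ℂ}, (∀ m p q, HasRSIntegral (expChar m * K)
      (fun x => H x p q) (-Real.pi) Real.pi (D m p q)) → ∀ (v : Fin T → ℂ) m,
      HasRSIntegral (expChar m * K) (fun y => star v ⬝ᵥ (H y).mulVec v) (-Real.pi) Real.pi
        (star v ⬝ᵥ (D m).mulVec v) := fun hH v m => by
    simp_rw [hform]
    exact .sum fun p _ => .sum fun q _ => (hH m p q).const_smul _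
  refine eq_of_star_dotProduct_mulVec_eq fun v => ?_
  simp_rw [Matrix.sub_mulVec, dotProduct_sub]
  exact increment_eq_of_hasRSIntegral (hmono hG v) (hcont hG v) (hmono hF v) (hcont hF v) hK hK0
    (hRS hGD v) (hRS hFD v) le_rfl hx.1 hx.2

/-! ### The spectral process and the spectral function of the increments -/

section SpectralRepresentation

open scoped InnerProductSpace

lemma isStep_one {r : ℕ} : IsStep (1 : Fin r → ℤ) := Or.inl fun _ => one_pos

section L2

variable {Ω : Type*} [MeasurableSpace Ω] {P : Measure Ω}

lemma integral_mul_conj_eq_inner (X Y : Lp ℂ 2 P) : ∫ ω, X ω * conj (Y ω) ∂P = ⟪Y, X⟫_ℂ := by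
  rw [L2.inner_def]
  rfl

lemma integral_mul_conj_eq_inner_toLp {X Y : Ω → ℂ} (hX : MemLp X 2 P) (hY : MemLp Y 2 P) :
    ∫ ω, X ω * conj (Y ω) ∂P = ⟪hY.toLp Y, hX.toLp X⟫_ℂ := by
  rw [← integral_mul_conj_eq_inner]
  refine integral_congr_ae ?_
  filter_upwards [hX.coeFn_toLp, hY.coeFn_toLp] with ω h₁ h₂
  rw [h₁, h₂]

lemma integral_eq_inner_const [IsProbabilityMeasure P] (X : Lp ℂ 2 P) :
    ∫ ω, X ω ∂P = ⟪Lp.const 2 P (1 : ℂ), X⟫_ℂ := by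
  rw [← integral_mul_conj_eq_inner]
  refine integral_congr_ae ?_
  filter_upwards [Lp.coeFn_const 2 P (1 : ℂ)] with ω h
  rw [h]
  simp

end L2

lemma periodLp_indicator_sub {σ : Measure Torus} [IsFiniteMeasure σ] {h : ℝ → ℂ}
    (hh : IsBoundedOnPeriod h) {a b : ℝ} (ha : -Real.pi ≤ a) (hab : a ≤ b) :
    periodLp σ ((Set.Ico (-Real.pi) b).indicator h) -
      periodLp σ ((Set.Ico (-Real.pi) a).indicator h) = periodLp σ ((Set.Ico a b).indicator h) := by
  rw [← periodLp_sub (hh.indicator measurableSet_Ico) (hh.indicator measurableSet_Ico),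
    ← Set.indicator_sdiff (Set.Ico_subset_Ico_right hab)]
  congr 2
  ext x
  simp only [Set.mem_sdiff, Set.mem_Ico, not_and, not_lt]
  exact ⟨fun hx => ⟨hx.2 hx.1.1, hx.1.2⟩, fun hx => ⟨⟨ha.trans hx.1, hx.2⟩, fun _ => hx.1⟩⟩

lemma continuousWithinAt_periodLp_indicator {σ : Measure Torus} [IsFiniteMeasure σ] {h : ℝ → ℂ}
    (hh : IsBoundedOnPeriod h) (x : ℝ) :
    ContinuousWithinAt (fun y => periodLp σ ((Set.Ico (-Real.pi) y).indicator h))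
      (Set.Iio x) x := by
  obtain ⟨C, -, hC⟩ := hh.bounded
  refine tendsto_periodLp (C := C) (fun y => hh.indicator measurableSet_Ico)
    (hh.indicator measurableSet_Ico)
    (fun y z hz => (norm_indicator_le_norm_self h z).trans (hC z hz)) fun z hz => ?_
  rcases lt_or_ge z x with hzx | hzx
  · refine tendsto_const_nhds.congr' ?_
    filter_upwards [Ioo_mem_nhdsLT hzx] with y hy
    rw [Set.indicator_of_mem (show z ∈ Set.Ico (-Real.pi) x from ⟨hz.1, hzx⟩),
      Set.indicator_of_mem (show z ∈ Set.Ico (-Real.pi) y from ⟨hz.1, hy.1⟩)]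
  · refine tendsto_const_nhds.congr' ?_
    filter_upwards [self_mem_nhdsWithin] with y hy
    rw [Set.indicator_of_notMem (fun h => (h.2.trans_le hzx).false),
      Set.indicator_of_notMem (fun h => (h.2.trans ((Set.mem_Iio.1 hy).trans_le hzx)).false)]

section Representation

variable {E ι : Type*} [NormedAddCommGroup E] [InnerProductSpace ℂ E] {η : ι → ℤ → E}
  {σ : Measure Torus} [IsFiniteMeasure σ] {V : ι → Lp ℂ 2 σ →L[ℂ] E} {h : ℝ → ℂ}

/-- The process `x ↦ ∫_{-π}^x h dζ`, where `ζ` is the random measure of the spectral operators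
`V`. -/
noncomputable def spectralIntegral (V : ι → Lp ℂ 2 σ →L[ℂ] E) (h : ℝ → ℂ) (p : ι) (x : ℝ) : E :=
  V p (periodLp σ ((Set.Ico (-Real.pi) x).indicator h))

/-- The distribution function of the matrix spectral measure of `spectralIntegral V h`. -/
noncomputable def spectralDistribution (V : ι → Lp ℂ 2 σ →L[ℂ] E) (h : ℝ → ℂ) (x : ℝ) :
    Matrix ι ι ℂ := fun p q =>
  crossFunctional V p q
    (periodLp σ ((Set.Ico (-Real.pi) x).indicator (h * fun y => conj (h y))))

lemma spectralIntegral_sub (hh : IsBoundedOnPeriod h) (p : ι) {a b : ℝ} (ha : -Real.pi ≤ a)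
    (hab : a ≤ b) : spectralIntegral V h p b - spectralIntegral V h p a =
      V p (periodLp σ ((Set.Ico a b).indicator h)) := by
  rw [spectralIntegral, spectralIntegral, ← map_sub, periodLp_indicator_sub hh ha hab]

lemma spectralDistribution_sub (hh : IsBoundedOnPeriod h) (p q : ι) {a b : ℝ}
    (ha : -Real.pi ≤ a) (hab : a ≤ b) :
    spectralDistribution V h b p q - spectralDistribution V h a p q =
      crossFunctional V p q (periodLp σ ((Set.Ico a b).indicator (h * fun y => conj (h y)))) := by
  rw [spectralDistribution, spectralDistribution, ← map_sub,
    periodLp_indicator_sub (hh.mul hh.star) ha hab]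

lemma inner_spectralIntegral_sub (hη : ∀ p q m n k, ⟪η p (m + k), η q (n + k)⟫_ℂ = ⟪η p m, η q n⟫_ℂ)
    (hV : ∀ p m, V p (periodLp σ (expChar m)) = η p m) (hh : IsBoundedOnPeriod h) (p q : ι)
    {a b : ℝ} (ha : -Real.pi ≤ a) (hab : a ≤ b) :
    ⟪spectralIntegral V h q b - spectralIntegral V h q a,
      spectralIntegral V h p b - spectralIntegral V h p a⟫_ℂ =
      spectralDistribution V h b p q - spectralDistribution V h a p q := by
  have hi := hh.indicator (measurableSet_Ico (a := a) (b := b))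
  rw [spectralIntegral_sub hh p ha hab, spectralIntegral_sub hh q ha hab,
    spectralDistribution_sub hh p q ha hab, inner_eq_crossFunctional hη hV p q hi hi]
  congr 2
  ext x
  by_cases hx : x ∈ Set.Ico a b
  · simp only [Pi.mul_apply, Set.indicator_of_mem hx]
  · simp only [Pi.mul_apply, Set.indicator_of_notMem hx, zero_mul]

lemma inner_spectralIntegral_sub_eq_zero
    (hη : ∀ p q m n k, ⟪η p (m + k), η q (n + k)⟫_ℂ = ⟪η p m, η q n⟫_ℂ)
    (hV : ∀ p m, V p (periodLp σ (expChar m)) = η p m) (hh : IsBoundedOnPeriod h) (p q : ι)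
    {a b a' b' : ℝ} (ha : -Real.pi ≤ a) (hab : a ≤ b) (hb : b ≤ a') (hab' : a' ≤ b') :
    ⟪spectralIntegral V h q b' - spectralIntegral V h q a',
      spectralIntegral V h p b - spectralIntegral V h p a⟫_ℂ = 0 := by
  rw [spectralIntegral_sub hh p ha hab, spectralIntegral_sub hh q ((ha.trans hab).trans hb) hab',
    inner_eq_crossFunctional hη hV p q (hh.indicator measurableSet_Ico)
      (hh.indicator measurableSet_Ico)]
  have h0 : ((Set.Ico a b).indicator h * fun x => conj ((Set.Ico a' b').indicator h x)) =
      (0 : ℂ) • expChar 0 := by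
    ext x
    by_cases hx : x ∈ Set.Ico a b
    · have hx' : x ∉ Set.Ico a' b' := fun hx' => (hx.2.trans_le (hb.trans hx'.1)).false
      rw [Pi.mul_apply, Set.indicator_of_notMem hx']
      simp
    · rw [Pi.mul_apply, Set.indicator_of_notMem hx]
      simp
  rw [h0, periodLp_smul 0 (.expChar 0), zero_smul, map_zero]

lemma isMatrixDistribution_spectralDistribution {T : ℕ} {η : Fin T → ℤ → E}
    {V : Fin T → Lp ℂ 2 σ →L[ℂ] E}
    (hη : ∀ p q m n k, ⟪η p (m + k), η q (n + k)⟫_ℂ = ⟪η p m, η q n⟫_ℂ)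
    (hV : ∀ p m, V p (periodLp σ (expChar m)) = η p m) (hh : IsBoundedOnPeriod h) :
    IsMatrixDistribution (spectralDistribution V h) where
  mono a b ha hab _ := by
    have hgram : spectralDistribution V h b - spectralDistribution V h a = (Matrix.gram ℂ fun p =>
        spectralIntegral V h p b - spectralIntegral V h p a).transpose := by
      ext p q
      exact (inner_spectralIntegral_sub hη hV hh p q ha hab).symm
    rw [hgram]
    exact (Matrix.posSemidef_gram ℂ _).transpose
  left_cont x _ _ := by
    refine continuousWithinAt_pi.2 fun p => continuousWithinAt_pi.2 fun q => ?_
    exact (crossFunctional V p q).continuous.continuousAt.comp_continuousWithinAt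
      (continuousWithinAt_periodLp_indicator (hh.mul hh.star) x)

end Representation

section GM

variable {Ω : Type*} [MeasurableSpace Ω] {P : Measure Ω} {r T : ℕ} {s d : Fin r → ℕ}
  {ξ : Fin T → ℤ → Ω → ℂ}

/-- The stationary sequence of increments with unit steps, in `L²(P)`. -/
noncomputable def unitIncrement (hξ : IsStationaryGM P s d ξ) (p : Fin T) (m : ℤ) : Lp ℂ 2 P :=
  (hξ.memLp 1 isStep_one p m).toLp (gmIncrement s d 1 (ξ p) m)

lemma inner_unitIncrement_add (hξ : IsStationaryGM P s d ξ) (p q : Fin T) (m n k : ℤ) :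
    ⟪unitIncrement hξ p (m + k), unitIncrement hξ q (n + k)⟫_ℂ =
      ⟪unitIncrement hξ p m, unitIncrement hξ q n⟫_ℂ := by
  have key : ∀ m n, ⟪unitIncrement hξ p m, unitIncrement hξ q n⟫_ℂ =
      structuralFunction P s d ξ (n - m) 1 1 q p := fun m n => by
    rw [unitIncrement, unitIncrement, ← integral_mul_conj_eq_inner_toLp, structuralFunction,
      ← hξ.structural 1 1 isStep_one isStep_one q p (n - m) m, add_sub_cancel]
  rw [key, key, add_sub_add_right_eq_sub]

lemma integral_unitIncrement (hξ : IsStationaryGM P s d ξ) (p : Fin T) (m : ℤ) :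
    ∫ ω, unitIncrement hξ p m ω ∂P = ∫ ω, unitIncrement hξ p 0 ω ∂P := by
  have key : ∀ m, ∫ ω, unitIncrement hξ p m ω ∂P = ∫ ω, gmIncrement s d 1 (ξ p) m ω ∂P :=
    fun m => integral_congr_ae (MemLp.coeFn_toLp _)
  rw [key, key, hξ.mean 1 isStep_one p m]

/-- The transfer function `Q` from unit steps to the step `μ`, on the level of symbols and on the
level of spectral representations. -/
lemma exists_transferFunction (hξ : IsStationaryGM P s d ξ) {μ : Fin r → ℤ} (hμ : IsStep μ) :
    ∃ Q : ℂ → ℂ, ContinuousOn Q {0}ᶜ ∧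
      (∀ z : ℂ, z ≠ 0 → gmSymbol s d μ z = Q z * gmSymbol s d 1 z) ∧
      ∀ (σ : Measure Torus) [IsFiniteMeasure σ] (V : Fin T → Lp ℂ 2 σ →L[ℂ] Lp ℂ 2 P),
        (∀ p m, V p (periodLp σ (expChar m)) = unitIncrement hξ p m) → ∀ p m,
        V p (periodLp σ (expChar m * fun x : ℝ => Q (Complex.exp (-(Complex.I * (x : ℂ)))))) =
          (hξ.memLp μ hμ p m).toLp (gmIncrement s d μ (ξ p) m) := by
  obtain ⟨S, c, hinc, hsym⟩ := exists_movingAverage (Ω := Ω) s d μ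
  refine ⟨fun z => ∑ k ∈ S, c k * z ^ k, ?_, hsym, fun σ _ V hV p m => ?_⟩
  · exact continuousOn_finsetSum _ fun k _ => continuousOn_const.mul
      fun z hz => (continuousAt_zpow₀ z k (Or.inl hz)).continuousWithinAt
  have h1 : (expChar m * fun x : ℝ => ∑ k ∈ S, c k * Complex.exp (-(Complex.I * (x : ℂ))) ^ k) =
      ∑ k ∈ S, c k • expChar (m - k) := by
    ext x
    rw [Pi.mul_apply, Finset.mul_sum, Finset.sum_apply]
    refine Finset.sum_congr rfl fun k _ => ?_
    rw [Pi.smul_apply, smul_eq_mul, sub_eq_add_neg, expChar_add, ← Complex.exp_int_mul,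
      show (k : ℂ) * -(Complex.I * x) = Complex.I * ((-k : ℤ) : ℂ) * x by push_cast; ring]
    rw [← expChar]
    ring
  rw [h1, periodLp_sum fun k _ => (IsBoundedOnPeriod.expChar _).const_smul _, map_sum]
  simp_rw [periodLp_smul _ (IsBoundedOnPeriod.expChar _), map_smul, hV]
  refine Lp.ext ?_
  have h2 : ∀ᵐ ω ∂P, ∀ k, (c k • unitIncrement hξ p (m - k)) ω =
      c k * gmIncrement s d 1 (ξ p) (m - k) ω := by
    refine ae_all_iff.2 fun k => ?_
    filter_upwards [Lp.coeFn_smul (c k) (unitIncrement hξ p (m - k)),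
      (hξ.memLp 1 isStep_one p (m - k)).coeFn_toLp] with ω h₁ h₂
    rw [h₁, Pi.smul_apply, smul_eq_mul, unitIncrement, h₂]
  filter_upwards [h2, Lp.coeFn_finsetSum S fun k => c k • unitIncrement hξ p (m - k),
    (hξ.memLp μ hμ p m).coeFn_toLp] with ω h₁ h₂ h₃
  rw [h₂, h₃, hinc, Finset.sum_apply]
  exact Finset.sum_congr rfl fun k _ => h₁ k

end GM

end SpectralRepresentation

theorem mainTheorem7 {Ω : Type*} [MeasurableSpace Ω] (P : Measure Ω) [IsProbabilityMeasure P]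
    {r T : ℕ} (s d : Fin r → ℕ) (hs : ∀ i, 0 < s i) (hd : ∀ i, 0 < d i)
    (ξ : Fin T → ℤ → Ω → ℂ) (hξ : IsStationaryGM P s d ξ) :
    ∃ F : ℝ → Matrix (Fin T) (Fin T) ℂ,
      IsSpectralFunction P s d ξ F ∧
      (∀ G : ℝ → Matrix (Fin T) (Fin T) ℂ, IsSpectralFunction P s d ξ G →
        ∀ x ∈ Set.Icc (-Real.pi) Real.pi, G x - G (-Real.pi) = F x - F (-Real.pi)) ∧
      ∃ Z : Fin T → ℝ → Lp ℂ 2 P,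
        HasUncorrelatedIncrements P Z ∧
        (∀ a b, -Real.pi ≤ a → a < b → b ≤ Real.pi → ∀ p q : Fin T,
          ∫ ω, (Z p b - Z p a) ω * conj ((Z q b - Z q a) ω) ∂P = F b p q - F a p q) ∧
        ∀ (μ : Fin r → ℤ) (hμ : IsStep μ) (m : ℤ) (p : Fin T),
          HasRSIntegral (spectralKernel s d μ m) (Z p) (-Real.pi) Real.pi
            ((hξ.memLp μ hμ p m).toLp (gmIncrement s d μ (ξ p) m)) := by
  obtain ⟨κ, hκ, hκβ, hκ0⟩ := exists_continuous_quotient s d hs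
  have hη := inner_unitIncrement_add hξ
  obtain ⟨σ, _, V, hV⟩ := exists_spectral_operators hη
  have hh : IsBoundedOnPeriod fun x => (κ x)⁻¹ :=
    .of_continuousOn hκ.measurable.inv (hκ.continuousOn.inv₀ hκ0)
  have hcomp : ∀ {Q : ℂ → ℂ}, ContinuousOn Q {0}ᶜ →
      Continuous fun x : ℝ => Q (Complex.exp (-(Complex.I * (x : ℂ)))) := fun hQ =>
    hQ.comp_continuous (by fun_prop) fun x => Complex.exp_ne_zero _
  have hF : IsSpectralFunction P s d ξ (spectralDistribution V fun x => (κ x)⁻¹) := by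
    refine ⟨isMatrixDistribution_spectralDistribution hη hV hh, fun μ₁ μ₂ hμ₁ hμ₂ m p q => ?_⟩
    obtain ⟨Q₁, hQ₁, hs₁, hV₁⟩ := exists_transferFunction hξ hμ₁
    obtain ⟨Q₂, hQ₂, hs₂, hV₂⟩ := exists_transferFunction hξ hμ₂
    have hker := structuralKernel_eq hκ hκβ hQ₁ hQ₂ hs₁ hs₂ m
    have hkc : Continuous (structuralKernel s d μ₁ μ₂ m) := by
      rw [funext hker]
      exact (continuous_expChar m).mul (((hcomp hQ₁).mul hκ).mul
        (Complex.continuous_conj.comp ((hcomp hQ₂).mul hκ)))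
    have hRS := hasRSIntegral_of_increments (crossFunctional V p q)
      (G := fun x => spectralDistribution V (fun x => (κ x)⁻¹) x p q) (hh.mul hh.star) hkc
      fun a b ha hab _ => spectralDistribution_sub hh p q ha hab
    have hval : structuralFunction P s d ξ m μ₁ μ₂ p q = crossFunctional V p q (periodLp σ
        (structuralKernel s d μ₁ μ₂ m *
          ((fun x => (κ x)⁻¹) * fun x => conj ((fun x => (κ x)⁻¹) x)))) := by
      rw [structuralFunction, integral_mul_conj_eq_inner_toLp (hξ.memLp μ₁ hμ₁ p m)
        (hξ.memLp μ₂ hμ₂ q 0), ← hV₁ σ V hV p m, ← hV₂ σ V hV q 0,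
        inner_eq_crossFunctional hη hV p q (.mul (.expChar m) (.of_continuous (hcomp hQ₁)))
          (.mul (.expChar 0) (.of_continuous (hcomp hQ₂)))]
      congr 1
      refine periodLp_congr fun x hx => ?_
      have hx0 := hκ0 x (Set.Ico_subset_Icc_self hx)
      have hx0' : conj (κ x) ≠ 0 := (map_ne_zero _).2 hx0
      simp only [Pi.mul_apply, hker, ← expChar.eq_1, map_mul, map_inv₀]
      simp only [expChar, Int.cast_zero, mul_zero, zero_mul, Complex.exp_zero, map_one]
      field_simp
    rw [hval]
    exact hRS
  refine ⟨_, hF, fun G hG x hx => ?_, spectralIntegral V fun x => (κ x)⁻¹, ⟨?_, ?_⟩, ?_, ?_⟩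
  · -- for unit steps the structural kernel is `e^(imx) |κ x|²`
    have hker : ∀ m, structuralKernel s d (1 : Fin r → ℤ) 1 m =
        expChar m * fun x => κ x * conj (κ x) := fun m => by
      ext x
      rw [structuralKernel_eq hκ hκβ (Q₁ := fun _ => 1) (Q₂ := fun _ => 1) continuousOn_const
        continuousOn_const (fun _ _ => (one_mul _).symm) (fun _ _ => (one_mul _).symm)]
      simp [expChar]
    refine hF.1.sub_eq_sub hG.1 (K := fun x => κ x * conj (κ x))
      (D := fun m => structuralFunction P s d ξ m 1 1)
      (hκ.mul (Complex.continuous_conj.comp hκ))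
      (fun x hx => mul_ne_zero (hκ0 x hx) ((map_ne_zero _).2 (hκ0 x hx)))
      (fun m p q => ?_) (fun m p q => ?_) hx
    · rw [← hker]
      exact hF.2 1 1 isStep_one isStep_one m p q
    · rw [← hker]
      exact hG.2 1 1 isStep_one isStep_one m p q
  · intro p q a b a' b' ha hab hb hab' hb'
    rw [integral_mul_conj_eq_inner, inner_spectralIntegral_sub_eq_zero hη hV hh p q ha hab hb hab']
    -- the mean of the random spectral measure is carried by the frequency `0`
    have hmean : ∀ p a b, -Real.pi ≤ a → a ≤ b → (0 : ℝ) ∉ Set.Ico a b →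
        ∫ ω, (spectralIntegral V (fun x => (κ x)⁻¹) p b -
          spectralIntegral V (fun x => (κ x)⁻¹) p a) ω ∂P = 0 := by
      intro p a b ha hab h0
      rw [integral_eq_inner_const, spectralIntegral_sub hh p ha hab]
      refine eq_zero_of_const_on_expChar
        (L := (innerSL ℂ (Lp.const 2 P (1 : ℂ))).comp (V p)) (fun m => ?_)
        (hh.indicator measurableSet_Ico) (Set.indicator_of_notMem h0 _)
      simp only [ContinuousLinearMap.comp_apply, innerSL_apply_apply, hV,
        ← integral_eq_inner_const]
      exact integral_unitIncrement hξ p m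
    by_cases h0 : (0 : ℝ) ∈ Set.Ico a b
    · rw [hmean q a' b' ((ha.trans hab).trans hb) hab'
        fun h0' => (h0.2.trans_le (hb.trans h0'.1)).false, map_zero, mul_zero]
    · rw [hmean p a b ha hab h0, zero_mul]
  · intro p q a b a' b' ha hab hb hab' hb'
    rw [integral_mul_conj_eq_inner, inner_spectralIntegral_sub_eq_zero hη hV hh p q ha hab hb hab']
  · intro a b ha hab hb p q
    rw [integral_mul_conj_eq_inner, inner_spectralIntegral_sub hη hV hh p q ha hab.le]
  · intro μ hμ m p
    obtain ⟨Q, hQ, hsym, hVQ⟩ := exists_transferFunction hξ hμ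
    have hker := spectralKernel_eq hκ hκβ hQ hsym m
    have hkc : Continuous (spectralKernel s d μ m) := by
      rw [funext hker]
      exact (continuous_expChar m).mul ((hcomp hQ).mul hκ)
    have hRS := hasRSIntegral_of_increments (V p)
      (G := spectralIntegral V (fun x => (κ x)⁻¹) p) hh hkc
      fun a b ha hab _ => spectralIntegral_sub hh p ha hab
    rw [← hVQ σ V hV p m]
    convert hRS using 2
    refine periodLp_congr fun x hx => ?_
    have hx0 := hκ0 x (Set.Ico_subset_Icc_self hx)
    simp only [Pi.mul_apply, hker, expChar]
    field_simp
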